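/- Let $p=\sum_{i=1}^I p_i$ and partition vectors in $\mathbb R^p$ into $I$ sub-vectors $x^k\in\mathbb R^{p_k}$ and $p\times p$ matrices into blocks $A^{k\ell}\in\mathbb R^{p_k\times p_\ell}$. $\|\cdot\|_2$ is the Euclidean norm of a vector and the Frobenius norm of a matrix, $\langle A,B\rangle=\operatorname{tr}(AB^{\top})$, and $J_2(x)=\{k:\|x^k\|_2\ne 0\}$. Let $w_{k\ell}>0$ be weights, $w_0=\min_{k,\ell}w_{k\ell}$, $w_1=\max_{k,\ell}w_{k\ell}$, and let $\lambda\ge 0$. Let $\Sigma_1=\sum_{j=1}^r\gamma_j v_jv_j^{\top}$ with $v_1,\dots,v_r\in\mathbb R^p$ orthonormal, $\gamma_1>\dots>\gamma_r>0$, and put $\gamma_{r+1}=0$. Let $S$ be a symmetric $p\times p$ matrix and $E=S-\Sigma_1$. Estimates $\hat v_1,\hat v_2,\dots$ are formed sequentially: with $\hat\Pi_0=0$ and $\hat\Pi_j=\sum_{k\le j}\hat v_k\hat v_k^{\top}$, let $\hat H_j$ be a maximizer of the purely group-penalized objective $$\langle S,H\rangle-\lambda\sum_{k,\ell}w_{k\ell}\|H^{k\ell}\|_2\quad\text{over}\quad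 \{H: 0\preceq H\preceq I_p,\ \operatorname{tr}H=1,\ \langle H,\hat\Pi_{j-1}\rangle=0\},$$ and let $\hat v_j$ be a unit eigenvector of $\hat H_j$ for its largest eigenvalue. Fix $r_1\le r$ and put $J_2=\bigcup_{j=1}^{r_1}J_2(v_j)$, $s_2=|J_2|$, $\Pi_j=\sum_{k\le j}v_kv_k^{\top}$, $\epsilon_0=0$, $\epsilon_j=\max(\|\Pi_j-\hat\Pi_j\|_2,\|\hat v_j-v_j\|_2)$ for $j\ge1$, $$b_j=\sum_{k=1}^j\frac{4\,[\,2\lambda s_2w_1+2\gamma_k\epsilon_{k-1}+\gamma_1\epsilon_{k-1}^2\,]}{\gamma_k-\gamma_{k+1}},\qquad \|E\|^*_{\infty,\infty}=\max_{k,\ell}\frac{\|E^{k\ell}\|_2}{w_{k\ell}},$$ $$\|(\Sigma_1)^{J_2^cJ_2}\|^*_{2,\infty}=\max_{\ell\in J_2^c}\Big(\sum_{k\in J_2}\|(\Sigma_1)^{k\ell}\|_2^2/w_{k\ell}^2\Big)^{1/2}\quad(=0\text{ if }J_2^c=\emptyset).$$ Let $1\le m\le r_1$, let $\hat v_1,\dots,\hat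 v_{m-1}$ be estimates obtained by the first $m-1$ steps, and suppose that for $1\le j\le m$ $$\|E\|^*_{\infty,\infty}+b_j\,\|(\Sigma_1)^{J_2^cJ_2}\|^*_{2,\infty}\le\frac{w_0}{w_1}\lambda,\qquad 0<\gamma_j-\gamma_{j+1}-4(\lambda s_2w_1+\gamma_1b_j).$$ (Only $\hat v_1,\dots,\hat v_{m-1}$ enter these conditions.) Then the problem of step $m$ has exactly one maximizer $\hat H_m$, the estimate $\hat v_m$ exists and is unique up to sign, and $J_2(\hat v_m)\subseteq J_2$. In particular, if the two conditions hold for all $1\le j\le r_1$, then $\hat v_j$ exists, is unique up to sign, and satisfies $J_2(\hat v_j)\subseteq J_2$ for every $j=1,\dots,r_1$. -/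

import Mathlib

namespace MultiviewPCA

open Finset

/-- Coordinates of a concatenated vector with `I` views, the `i`-th of dimension `p i`. -/
abbrev Coord {I : ℕ} (p : Fin I → ℕ) : Type := Σ i : Fin I, Fin (p i)

/-- The space `ℝ^p`, `p = ∑ i, p i`, with its Euclidean norm. -/
abbrev Vec {I : ℕ} (p : Fin I → ℕ) : Type := EuclideanSpace ℝ (Coord p)

/-- Real `p × p` matrices, partitioned into `I × I` blocks. -/
abbrev Mat {I : ℕ} (p : Fin I → ℕ) : Type := Matrix (Coord p) (Coord p) ℝ

/-- The Frobenius norm `‖A‖₂`. -/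
noncomputable def frob {m n : Type*} [Fintype m] [Fintype n] (A : Matrix m n ℝ) : ℝ :=
  Real.sqrt (∑ i, ∑ j, A i j ^ 2)

/-- The trace inner product `⟨A, B⟩ = tr (A Bᵀ)`. -/
def traceInner {n : Type*} [Fintype n] (A B : Matrix n n ℝ) : ℝ :=
  (A * B.transpose).trace

variable {I : ℕ} {p : Fin I → ℕ}

/-- The `(k, l)` block of a matrix. -/
def block (A : Mat p) (k l : Fin I) : Matrix (Fin (p k)) (Fin (p l)) ℝ :=
  Matrix.of fun a b => A ⟨k, a⟩ ⟨l, b⟩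

/-- The `k`-th sub vector of a vector. -/
def subVec (x : Vec p) (k : Fin I) : EuclideanSpace ℝ (Fin (p k)) :=
  WithLp.toLp 2 fun a => x ⟨k, a⟩

/-- The block support `{k : ‖x^k‖₂ ≠ 0}`. -/
noncomputable def blockSupport (x : Vec p) : Finset (Fin I) :=
  by classical exact Finset.univ.filter fun k => ‖subVec x k‖ ≠ 0

/-- The rank one matrix `x xᵀ`. -/
def outer (x : Vec p) : Mat p :=
  Matrix.of fun s t => x s * x t

/-- `∑_{k=1}^{j} u_k u_kᵀ`; it is `0` for `j = 0`. -/
def projSum (u : ℕ → Vec p) (j : ℕ) : Mat p :=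
  ∑ k ∈ Icc 1 j, outer (u k)

/-! ### The optimization problem -/

/-- The entrywise norm `‖H‖₁,₁`. -/
def elementPenalty (H : Mat p) : ℝ :=
  ∑ s, ∑ t, |H s t|

/-- The group norm `‖H‖*₁,₁ = ∑_{k,l} w_{kl} ‖H^{kl}‖₂`. -/
noncomputable def groupPenalty (w : Fin I → Fin I → ℝ) (H : Mat p) : ℝ :=
  ∑ k, ∑ l, w k l * frob (block H k l)

/-- The penalized objective function. -/
noncomputable def objective (S : Mat p) (lam β : ℝ) (w : Fin I → Fin I → ℝ) (H : Mat p) : ℝ :=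
  traceInner S H - lam * β * elementPenalty H - lam * (1 - β) * groupPenalty w H

/-- The deflated Fantope `{H : 0 ⪯ H ⪯ I, tr H = 1, ⟨H, P⟩ = 0}`. -/
def deflatedFantope (P : Mat p) : Set (Mat p) :=
  {H | H.PosSemidef ∧ (1 - H).PosSemidef ∧ H.trace = 1 ∧ traceInner H P = 0}

/-- `H` solves the penalized problem over the deflated Fantope of `P`. -/
def IsSolution (S : Mat p) (lam β : ℝ) (w : Fin I → Fin I → ℝ) (P H : Mat p) : Prop :=
  H ∈ deflatedFantope P ∧ IsMaxOn (objective S lam β w) (deflatedFantope P) H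

/-- `x` is a unit eigenvector of `H` for the largest eigenvalue of `H`. -/
def IsLeadingEigenvector (H : Mat p) (x : Vec p) : Prop :=
  ‖x‖ = 1 ∧ ∃ μ : ℝ, Module.End.HasEigenvector (Matrix.toLin' H) μ x.ofLp ∧
    ∀ ν : ℝ, Module.End.HasEigenvalue (Matrix.toLin' H) ν → ν ≤ μ

/-- `x` is an eigenvector estimate, given the projection matrix `P` of the earlier estimates. -/
def IsEstimate (S : Mat p) (lam β : ℝ) (w : Fin I → Fin I → ℝ) (P : Mat p) (x : Vec p) : Prop :=
  ∃ H : Mat p, IsSolution S lam β w P H ∧ IsLeadingEigenvector H x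

/-- `vh 1, …, vh m` are obtained by the first `m` steps of the sequential procedure. -/
def IsEstimateSequence (S : Mat p) (lam β : ℝ) (w : Fin I → Fin I → ℝ) (m : ℕ)
    (vh : ℕ → Vec p) : Prop :=
  ∀ j ∈ Icc 1 m, IsEstimate S lam β w (projSum vh (j - 1)) (vh j)

/-! ### The signal matrix and the quantities in the conditions -/

/-- `Sig = ∑_{j=1}^r γ_j v_j v_jᵀ` with `v_1, …, v_r` orthonormal and `γ_1 > ⋯ > γ_r > 0`,
and with the usual convention `γ_{r+1} = 0`. -/
structure IsSignal (Sig : Mat p) (r : ℕ) (γ : ℕ → ℝ) (v : ℕ → Vec p) : Prop where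
  eq_sum : Sig = ∑ j ∈ Icc 1 r, γ j • outer (v j)
  orthonormal : ∀ j ∈ Icc 1 r, ∀ k ∈ Icc 1 r, inner ℝ (v j) (v k) = if j = k then (1 : ℝ) else 0
  pos : ∀ j ∈ Icc 1 r, 0 < γ j
  strictAnti : ∀ j ∈ Icc 1 r, ∀ k ∈ Icc 1 r, j < k → γ k < γ j
  next_eq_zero : γ (r + 1) = 0

/-- The smallest weight `w₀`. -/
noncomputable def minWeight (w : Fin I → Fin I → ℝ) : ℝ :=
  ⨅ q : Fin I × Fin I, w q.1 q.2

/-- The largest weight `w₁`. -/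
noncomputable def maxWeight (w : Fin I → Fin I → ℝ) : ℝ :=
  ⨆ q : Fin I × Fin I, w q.1 q.2

/-- `‖E‖*_{∞,∞} = max_{k,l} ‖E^{kl}‖₂ / w_{kl}`. -/
noncomputable def blockMaxNorm (w : Fin I → Fin I → ℝ) (E : Mat p) : ℝ :=
  ⨆ q : Fin I × Fin I, frob (block E q.1 q.2) / w q.1 q.2

/-- `‖A^{JᶜJ}‖*_{2,∞} = max_{l ∉ J} √(∑_{k ∈ J} ‖A^{kl}‖₂² / w_{kl}²)`; it is `0` if `Jᶜ = ∅`. -/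
noncomputable def crossNorm (w : Fin I → Fin I → ℝ) (J : Finset (Fin I)) (A : Mat p) : ℝ :=
  ⨆ l : {l : Fin I // l ∉ J},
    Real.sqrt (∑ k ∈ J, frob (block A k l) ^ 2 / w k l ^ 2)

/-- The union `J₂` of the block supports of `v_1, …, v_{r₁}`. -/
noncomputable def unionSupport (v : ℕ → Vec p) (r₁ : ℕ) : Finset (Fin I) :=
  by classical exact (Icc 1 r₁).biUnion fun j => blockSupport (v j)

/-- `ε_j = max (‖Π_j - Π̂_j‖₂, ‖v̂_j - v_j‖₂)` for `j ≥ 1`, and `ε_0 = 0`. -/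
noncomputable def eps (v vh : ℕ → Vec p) (j : ℕ) : ℝ :=
  if j = 0 then 0 else max (frob (projSum v j - projSum vh j)) ‖vh j - v j‖

/-- The constant `b_j` for `β = 0`; `s₂` is the number of elements of `J₂`. -/
noncomputable def bConst (lam : ℝ) (w : Fin I → Fin I → ℝ) (s₂ : ℕ) (γ : ℕ → ℝ)
    (v vh : ℕ → Vec p) (j : ℕ) : ℝ :=
  ∑ k ∈ Icc 1 j,
    4 * (2 * (lam * s₂ * maxWeight w) + 2 * γ k * eps v vh (k - 1) + γ 1 * eps v vh (k - 1) ^ 2)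
      / (γ k - γ (k + 1))

end MultiviewPCA

/-! The proof is a primal-dual witness argument, carried out one step at a time. Suppose the earlier
estimates are orthonormal and supported in J = J₂. Restricting the problem to matrices supported in
J × J, compactness gives a maximizer H₀, and Hahn–Banach gives a subgradient Y of the penalty at H₀
such that H₀ also maximizes the linear functional ⟨S - Y, ·⟩ (`exists_restricted_solution`).

On J × J, S - Y is Σ₁ plus E - Y, whose blocks have norm at most 2λw₁. Let u maximize the resulting
quadratic form over unit vectors supported in J and orthogonal to the earlier estimates. A
perturbation argument of Davis–Kahan type gives ‖u - v_m‖ ≤ b_m and leaves a spectral gap below u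
(`exists_leading_vector`).

Outside J × J, extend Y to Z by E plus c uᵀ + u cᵀ, where c is the part of Σ₁u outside J. This term
cancels the only coupling between u and the coordinates outside J, so u uᵀ is the unique maximizer
of ⟨S - Z, ·⟩ over the whole deflated Fantope. Since Σ₁v_m = γ_m v_m has no part outside J, c comes
from Σ₁(u - v_m) and is small; the first condition then bounds every block of Z by λw_{kl}. Thus Z
is a dual certificate and u uᵀ is the only solution (`isSolution_iff_of_certificate`). Its leading
eigenvectors are ±u, which feeds the induction over the steps. -/

namespace MultiviewPCA

/-! ### Perturbation of the leading eigenvector of a deflated operator -/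

section Operators

open scoped InnerProductSpace

variable {V : Type*} [NormedAddCommGroup V] [InnerProductSpace ℝ V]

/-- Norm bound for the perturbation of a deflated operator. -/
theorem norm_deflation_perturbation_le {T N P Q : V →L[ℝ] V} {ε δ γ₁ γm : ℝ}
    (hQ : ‖Q‖ ≤ 1) (hPT : P ∘L T = T ∘L P) (hD : ‖Q - P‖ ≤ ε)
    (hT1 : ‖T‖ ≤ γ₁) (hTP : ‖T ∘L P‖ ≤ γm) (hNn : ‖N‖ ≤ δ) :
    ‖Q ∘L (T + N) ∘L Q - P ∘L T ∘L P‖ ≤ δ + 2 * γm * ε + γ₁ * ε ^ 2 := by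
  have hε : 0 ≤ ε := (norm_nonneg _).trans hD
  have hδ : 0 ≤ δ := (norm_nonneg _).trans hNn
  have hγ1 : 0 ≤ γ₁ := (norm_nonneg _).trans hT1
  have hγm : 0 ≤ γm := (norm_nonneg _).trans hTP
  -- Terms of first order in `Q - P` meet `T ∘L P`, of norm at most `γm`; only the second-order term
  -- pays the full `γ₁`.
  have key : Q ∘L (T + N) ∘L Q - P ∘L T ∘L P
      = (Q - P) ∘L (T ∘L P) + (P ∘L T) ∘L (Q - P) + (Q - P) ∘L (T ∘L (Q - P))
        + Q ∘L (N ∘L Q) := by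
    ext x; simp; abel
  rw [key]
  have h1 : ‖(Q - P) ∘L (T ∘L P)‖ ≤ ε * γm :=
    (ContinuousLinearMap.opNorm_comp_le _ _).trans (by gcongr)
  have h2 : ‖(P ∘L T) ∘L (Q - P)‖ ≤ γm * ε :=
    (ContinuousLinearMap.opNorm_comp_le _ _).trans (by rw [hPT]; gcongr)
  have h3 : ‖(Q - P) ∘L (T ∘L (Q - P))‖ ≤ ε * (γ₁ * ε) := by
    refine (ContinuousLinearMap.opNorm_comp_le _ _).trans ?_
    gcongr
    exact (ContinuousLinearMap.opNorm_comp_le _ _).trans (by gcongr)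
  have h4 : ‖Q ∘L (N ∘L Q)‖ ≤ 1 * (δ * 1) := by
    refine (ContinuousLinearMap.opNorm_comp_le _ _).trans ?_
    gcongr
    exact (ContinuousLinearMap.opNorm_comp_le _ _).trans (by gcongr)
  calc _ ≤ ‖(Q - P) ∘L (T ∘L P)‖ + ‖(P ∘L T) ∘L (Q - P)‖ + ‖(Q - P) ∘L (T ∘L (Q - P))‖
        + ‖Q ∘L (N ∘L Q)‖ := norm_add₄_le
    _ ≤ _ := by nlinarith

/-- This supplies the first-order condition at a maximum. The choice `t = a / (|b| + 1)` makes the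
linear term outweigh the quadratic one. -/
theorem eq_zero_of_forall_quadratic_nonpos {a b : ℝ} (h : ∀ t : ℝ, 2 * t * a + t ^ 2 * b ≤ 0) :
    a = 0 := by
  have h1 := h (a / (|b| + 1))
  have hb : 0 < |b| + 1 := by positivity
  have h2 : (2 * (a / (|b| + 1)) * a + (a / (|b| + 1)) ^ 2 * b) * (|b| + 1) ^ 2
      = a ^ 2 * (2 * (|b| + 1) + b) := by
    field_simp
  have h3 : a ^ 2 * (2 * (|b| + 1) + b) ≤ 0 := by
    rw [← h2]; exact mul_nonpos_of_nonpos_of_nonneg h1 (by positivity)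
  have h4 : 0 < 2 * (|b| + 1) + b := by linarith [neg_abs_le b, abs_nonneg b]
  have : a ^ 2 ≤ 0 := by
    by_contra hc
    push Not at hc
    nlinarith [mul_pos hc h4]
  exact pow_eq_zero_iff two_ne_zero |>.1 (le_antisymm this (sq_nonneg a))

/-- A quadratic form attains its maximum on the unit sphere of the common fixed space of two
continuous linear maps. -/
theorem exists_isMax_quadratic [FiniteDimensional ℝ V] (L Q R : V →L[ℝ] V) {y : V} (hy : y ≠ 0)
    (hQy : Q y = y) (hRy : R y = y) :
    ∃ u : V, ‖u‖ = 1 ∧ Q u = u ∧ R u = u ∧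
      ∀ x, Q x = x → R x = x → ⟪L x, x⟫_ℝ ≤ ⟪L u, u⟫_ℝ * ‖x‖ ^ 2 := by
  have hc : IsCompact {x : V | ‖x‖ = 1 ∧ Q x = x ∧ R x = x} := by
    have h1 : IsCompact (Metric.sphere (0 : V) 1) := isCompact_sphere _ _
    have h2 : IsClosed {x : V | Q x = x ∧ R x = x} :=
      (isClosed_eq Q.continuous continuous_id).inter (isClosed_eq R.continuous continuous_id)
    convert h1.inter_right h2 using 1
    ext x; simp
  have normalize : ∀ x : V, x ≠ 0 → Q x = x → R x = x →
      ‖x‖⁻¹ • x ∈ {x : V | ‖x‖ = 1 ∧ Q x = x ∧ R x = x} := by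
    intro x hx h1 h2
    refine ⟨?_, by simp [h1], by simp [h2]⟩
    rw [norm_smul, norm_inv, norm_norm, inv_mul_cancel₀ (norm_ne_zero_iff.2 hx)]
  obtain ⟨u, ⟨hu1, hu2, hu3⟩, hmax⟩ := hc.exists_isMaxOn ⟨_, normalize y hy hQy hRy⟩
    (f := fun x => ⟪L x, x⟫_ℝ) (by fun_prop)
  refine ⟨u, hu1, hu2, hu3, fun x h1 h2 => ?_⟩
  by_cases hx : x = 0
  · simp [hx]
  have h := hmax (normalize x hx h1 h2)
  simp only [Set.mem_ofPred_eq, map_smul, inner_smul_left, inner_smul_right, conj_trivial] at h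
  have hp : 0 < ‖x‖ := norm_pos_iff.2 hx
  calc ⟪L x, x⟫_ℝ = (‖x‖⁻¹ * (‖x‖⁻¹ * ⟪L x, x⟫_ℝ)) * ‖x‖ ^ 2 := by field_simp
    _ ≤ _ := by gcongr

/-- Distance of two unit vectors from a curvature inequality. -/
theorem mul_norm_sub_le {g η : ℝ} (hg : 0 < g) (hη : 0 ≤ η) {u v : V} (hu1 : ‖u‖ = 1)
    (hv : ‖v‖ = 1) (hsign : 0 ≤ ⟪v, u⟫_ℝ)
    (h : g * (1 - ⟪v, u⟫_ℝ ^ 2) ≤ η * (‖u - v‖ * ‖u + v‖)) : g * ‖u - v‖ ≤ 4 * η := by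
  have e3 : ‖u - v‖ ^ 2 = 2 - 2 * ⟪v, u⟫_ℝ := by
    rw [norm_sub_sq_real, hu1, hv, real_inner_comm]; ring
  have e4 : ‖u + v‖ ^ 2 = 2 + 2 * ⟪v, u⟫_ℝ := by
    rw [norm_add_sq_real, hu1, hv, real_inner_comm]; ring
  have e5 : 1 ≤ ‖u + v‖ := by nlinarith [norm_nonneg (u + v)]
  -- The constant 4 comes from `‖u - v‖² ‖u + v‖² = 4 (1 - ⟪v, u⟫²)`.
  have e6 : g * (‖u - v‖ * ‖u + v‖) ^ 2 ≤ 4 * η * (‖u - v‖ * ‖u + v‖) := by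
    rw [mul_pow, e3, e4]
    nlinarith
  rcases (norm_nonneg (u - v)).eq_or_lt with h0 | h0
  · rw [← h0]; simpa using hη
  · have hpos : 0 < ‖u - v‖ * ‖u + v‖ := by positivity
    have e7 : g * (‖u - v‖ * ‖u + v‖) ≤ 4 * η := by
      refine le_of_mul_le_mul_right ?_ hpos
      nlinarith
    have e8 : g * (‖u - v‖ * 1) ≤ g * (‖u - v‖ * ‖u + v‖) := by
      gcongr
    linarith

set_option maxHeartbeats 1000000 in
/-- Perturbation of the leading eigenvector of a deflated symmetric operator. The vector `u` is the
leading eigenvector of `T + N` on the common fixed space of `Q` and `R`. -/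
theorem exists_leading_vector [FiniteDimensional ℝ V] {T N P Q R : V →L[ℝ] V}
    {ε δ γ₁ γm γ' η : ℝ} {v : V}
    (hT : ∀ x y, ⟪T x, y⟫_ℝ = ⟪x, T y⟫_ℝ) (hN : ∀ x y, ⟪N x, y⟫_ℝ = ⟪x, N y⟫_ℝ)
    (hPs : ∀ x y, ⟪P x, y⟫_ℝ = ⟪x, P y⟫_ℝ) (hQs : ∀ x y, ⟪Q x, y⟫_ℝ = ⟪x, Q y⟫_ℝ)
    (hRs : ∀ x y, ⟪R x, y⟫_ℝ = ⟪x, R y⟫_ℝ)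
    (hQQ : ∀ x, Q (Q x) = Q x) (hRR : ∀ x, R (R x) = R x) (hQR : ∀ x, Q (R x) = R (Q x))
    (hRN : ∀ x, R (N x) = N x)
    (hQ : ‖Q‖ ≤ 1) (hPT : P ∘L T = T ∘L P) (hD : ‖Q - P‖ ≤ ε)
    (hT1 : ‖T‖ ≤ γ₁) (hTP : ‖T ∘L P‖ ≤ γm) (hNn : ‖N‖ ≤ δ)
    (hv : ‖v‖ = 1) (hPv : P v = v) (hRv : R v = v) (hTv : T v = γm • v)
    (hquad : ∀ x, ⟪T (P x), P x⟫_ℝ ≤ γ' * ‖x‖ ^ 2 + (γm - γ') * ⟪v, x⟫_ℝ ^ 2)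
    (hη : η = δ + 2 * γm * ε + γ₁ * ε ^ 2) (hγ' : 0 ≤ γ') (hgap : 16 * η < γm - γ')
    (hε : ε < 1) :
    ∃ u : V, ∃ μ κ : ℝ, ‖u‖ = 1 ∧ Q u = u ∧ R u = u ∧ (γm - γ') * ‖u - v‖ ≤ 4 * η ∧ 0 < κ ∧
      ⟪T u, u⟫_ℝ + ⟪N u, u⟫_ℝ = μ ∧
      ∀ x, Q x = x → ⟪T x, x⟫_ℝ + ⟪N x, x⟫_ℝ - 2 * ⟪T u - R (T u), x⟫_ℝ * ⟪u, x⟫_ℝ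
        ≤ μ * ‖x‖ ^ 2 - κ * ‖x - ⟪u, x⟫_ℝ • u‖ ^ 2 := by
  have hη0 : 0 ≤ η := by
    have h1 : 0 ≤ ε := (norm_nonneg _).trans hD
    have h2 : 0 ≤ δ := (norm_nonneg _).trans hNn
    have h3 : 0 ≤ γ₁ := (norm_nonneg _).trans hT1
    have h4 : 0 ≤ γm := (norm_nonneg _).trans hTP
    rw [hη]; positivity
  set W := Q ∘L (T + N) ∘L Q - P ∘L T ∘L P with hW
  have hWn : ‖W‖ ≤ η := hη ▸ norm_deflation_perturbation_le hQ hPT hD hT1 hTP hNn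
  have hWb : ∀ x y, |⟪W x, y⟫_ℝ| ≤ η * (‖x‖ * ‖y‖) := by
    intro x y
    refine (abs_real_inner_le_norm _ _).trans ?_
    rw [← mul_assoc]
    gcongr
    exact (W.le_opNorm x).trans (by gcongr)
  have hWs : ∀ x y, ⟪W x, y⟫_ℝ = ⟪x, W y⟫_ℝ := by
    intro x y
    simp only [hW, _root_.sub_apply, ContinuousLinearMap.comp_apply,
      _root_.add_apply, inner_sub_left, inner_sub_right]
    rw [hQs, inner_add_left, hT, hN, ← inner_add_right, hQs, hPs, hT, hPs]
  have hWq : ∀ x, ⟪T (Q x), Q x⟫_ℝ + ⟪N (Q x), Q x⟫_ℝ = ⟪T (P x), P x⟫_ℝ + ⟪W x, x⟫_ℝ := by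
    intro x
    simp only [hW, _root_.sub_apply, ContinuousLinearMap.comp_apply,
      _root_.add_apply, inner_sub_left]
    rw [hQs, inner_add_left, hPs]; ring
  have hQle : ∀ x, ‖Q x‖ ≤ ‖x‖ := fun x => by simpa using Q.le_of_opNorm_le hQ x
  -- If `Q v = 0`, then `Q - P` sends the unit vector `v` to `-v`, against `ε < 1`.
  have hy0 : Q v ≠ 0 := by
    intro h0
    have h1 : (Q - P) v = -v := by simp [h0, hPv]
    have h2 := (Q - P).le_of_opNorm_le hD v
    rw [h1, norm_neg, hv] at h2
    linarith
  obtain ⟨u₀, hu1₀, hQu₀, hRu₀, hmax₀⟩ := exists_isMax_quadratic (T + N) Q R hy0 (hQQ v)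
    (by rw [← hQR, hRv])
  obtain ⟨u, hu1, hQu, hRu, hmax, hsign⟩ : ∃ u : V, ‖u‖ = 1 ∧ Q u = u ∧ R u = u ∧
      (∀ x, Q x = x → R x = x → ⟪(T + N) x, x⟫_ℝ ≤ ⟪(T + N) u, u⟫_ℝ * ‖x‖ ^ 2) ∧
      0 ≤ ⟪v, u⟫_ℝ := by
    rcases le_total 0 ⟪v, u₀⟫_ℝ with h | h
    · exact ⟨u₀, hu1₀, hQu₀, hRu₀, hmax₀, h⟩
    · refine ⟨-u₀, by simpa, by simp [hQu₀], by simp [hRu₀], ?_, by simpa⟩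
      intro x h1 h2
      simpa only [map_neg, inner_neg_neg] using hmax₀ x h1 h2
  set μ := ⟪(T + N) u, u⟫_ℝ with hμ
  have hμ' : ⟪T u, u⟫_ℝ + ⟪N u, u⟫_ℝ = μ := by
    rw [hμ, _root_.add_apply, inner_add_left]
  have hmax' : ∀ x, Q x = x → R x = x → ⟪T x, x⟫_ℝ + ⟪N x, x⟫_ℝ ≤ μ * ‖x‖ ^ 2 := by
    intro x h1 h2
    have := hmax x h1 h2
    rwa [_root_.add_apply, inner_add_left] at this
  have huu : ⟪u, u⟫_ℝ = 1 := by rw [real_inner_self_eq_norm_sq, hu1]; norm_num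
  have hvv : ⟪v, v⟫_ℝ = 1 := by rw [real_inner_self_eq_norm_sq, hv]; norm_num
  -- comparison of `u` with the deflated `v`
  have hyv : γm + ⟪W v, v⟫_ℝ ≤ μ * ‖Q v‖ ^ 2 := by
    have h := hmax' (Q v) (hQQ v) (by rw [← hQR, hRv])
    rw [hWq, hPv, hTv, inner_smul_left, hvv] at h
    simpa using h
  have hWv : -η ≤ ⟪W v, v⟫_ℝ := by
    have := hWb v v
    rw [hv] at this
    linarith [neg_abs_le ⟪W v, v⟫_ℝ]
  -- Positivity of `μ` allows the factor `‖Q v‖² ≤ 1` in `hyv` to be dropped.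
  have hμpos : 0 < μ := by
    by_contra hc
    push Not at hc
    nlinarith [sq_nonneg ‖Q v‖]
  have hμv : γm + ⟪W v, v⟫_ℝ ≤ μ := by
    have h1 : ‖Q v‖ ^ 2 ≤ 1 := by
      have := hQle v
      rw [hv] at this
      nlinarith [norm_nonneg (Q v)]
    nlinarith
  have hμu : μ ≤ γ' + (γm - γ') * ⟪v, u⟫_ℝ ^ 2 + ⟪W u, u⟫_ℝ := by
    have h := hWq u
    rw [hQu, hμ'] at h
    have h2 := hquad u
    rw [hu1] at h2
    linarith
  have hdist : (γm - γ') * ‖u - v‖ ≤ 4 * η := by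
    -- Polarization makes the bound proportional to `‖u - v‖`; bounding the two terms separately
    -- would lose a square root.
    have e1 : ⟪W u, u⟫_ℝ - ⟪W v, v⟫_ℝ = ⟪W (u - v), u + v⟫_ℝ := by
      rw [map_sub, inner_sub_left, inner_add_right, inner_add_right, hWs v u,
        real_inner_comm (W u) v]
      ring
    have e2 := (le_abs_self _).trans (hWb (u - v) (u + v))
    exact mul_norm_sub_le (by linarith) hη0 hu1 hv hsign (by linarith)
  -- first order condition
  have hfirst : ∀ a, Q a = a → R a = a → ⟪u, a⟫_ℝ = 0 → ⟪T u, a⟫_ℝ + ⟪N u, a⟫_ℝ = 0 := by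
    intro a hQa hRa hua
    refine eq_zero_of_forall_quadratic_nonpos
      (b := ⟪T a, a⟫_ℝ + ⟪N a, a⟫_ℝ - μ * ‖a‖ ^ 2) fun t => ?_
    have h := hmax' (u + t • a) (by simp [hQu, hQa]) (by simp [hRu, hRa])
    have hn : ‖u + t • a‖ ^ 2 = 1 + t ^ 2 * ‖a‖ ^ 2 := by
      rw [norm_add_sq_real, hu1, inner_smul_right, hua, norm_smul, mul_pow]
      simp
    rw [hn] at h
    simp only [map_add, map_smul, inner_add_left, inner_add_right, inner_smul_left,
      inner_smul_right, conj_trivial] at h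
    rw [hT a u, hN a u, real_inner_comm (T u) a, real_inner_comm (N u) a] at h
    linear_combination h - hμ'
  -- The gap is what remains between `μ ≥ γm - η` and the bound `γ' + 2 * η` on the form
  -- orthogonally to `u` (`hLz`).
  refine ⟨u, μ, γm - γ' - 3 * η, hu1, hQu, hRu, hdist, by linarith, hμ', fun x hQx => ?_⟩
  set α := ⟪u, x⟫_ℝ with hα
  set z := x - α • u with hz
  have hQz : Q z = z := by simp [hz, hQx, hQu]
  have huz : ⟪u, z⟫_ℝ = 0 := by rw [hz, inner_sub_right, inner_smul_right, huu]; simp [hα]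
  -- Here `z` need not be fixed by `R`. The first-order condition removes the coupling with `R z`;
  -- as `N u` is fixed by `R`, only the part of `T u` outside the range of `R` survives. The
  -- correction term in the conclusion subtracts exactly this part.
  have hcross : ⟪T u, z⟫_ℝ + ⟪N u, z⟫_ℝ = ⟪T u - R (T u), x⟫_ℝ := by
    have h1 := hfirst (R z) (by rw [hQR, hQz]) (hRR z) (by rw [← hRs, hRu, huz])
    have h2 : ⟪N u, z⟫_ℝ = ⟪N u, R z⟫_ℝ := by rw [← hRs, hRN]
    have h3 : ⟪T u - R (T u), x⟫_ℝ = ⟪T u - R (T u), z⟫_ℝ := by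
      rw [hz, inner_sub_right, inner_smul_right, inner_sub_left _ _ u, hRs (T u) u, hRu]
      simp
    rw [h3, h2, inner_sub_left, hRs]
    linarith
  have hLz : ⟪T z, z⟫_ℝ + ⟪N z, z⟫_ℝ ≤ (γ' + 2 * η) * ‖z‖ ^ 2 := by
    have h1 := hWq z
    rw [hQz] at h1
    have h2 := hquad z
    have h3 := (le_abs_self _).trans (hWb z z)
    -- Since `z` is orthogonal to `u`, only `u - v` contributes to `⟪v, z⟫`. The factor 16 in `hgap`
    -- turns `(4 * η)²` into at most `(γm - γ') * η`.
    have h4 : (γm - γ') * ⟪v, z⟫_ℝ ^ 2 ≤ η * ‖z‖ ^ 2 := by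
      have e1 : ⟪v, z⟫_ℝ = -⟪u - v, z⟫_ℝ := by rw [inner_sub_left, huz]; ring
      have e2 : ⟪v, z⟫_ℝ ^ 2 ≤ (‖u - v‖ * ‖z‖) ^ 2 := by
        rw [e1, neg_sq, ← sq_abs]
        gcongr
        exact abs_real_inner_le_norm _ _
      have hg : 0 < γm - γ' := by linarith
      have e3 : (γm - γ') * ‖u - v‖ ^ 2 ≤ η := by
        refine le_of_mul_le_mul_left ?_ hg
        have : ((γm - γ') * ‖u - v‖) ^ 2 ≤ (4 * η) ^ 2 := by gcongr
        nlinarith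
      calc (γm - γ') * ⟪v, z⟫_ℝ ^ 2 ≤ (γm - γ') * (‖u - v‖ * ‖z‖) ^ 2 := by gcongr
        _ = ((γm - γ') * ‖u - v‖ ^ 2) * ‖z‖ ^ 2 := by ring
        _ ≤ _ := by gcongr
    linarith
  have hxz : x = α • u + z := by rw [hz]; abel
  have hnx : ‖x‖ ^ 2 = α ^ 2 + ‖z‖ ^ 2 := by
    rw [hxz, norm_add_sq_real, inner_smul_left, huz, norm_smul, mul_pow, hu1]
    simp
  have hLx : ⟪T x, x⟫_ℝ + ⟪N x, x⟫_ℝ = α ^ 2 * μ + 2 * α * ⟪T u - R (T u), x⟫_ℝ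
      + (⟪T z, z⟫_ℝ + ⟪N z, z⟫_ℝ) := by
    rw [← hcross, ← hμ']
    conv_lhs => rw [hxz]
    simp only [map_add, map_smul, inner_add_left, inner_add_right, inner_smul_left,
      inner_smul_right, conj_trivial]
    rw [hT z u, hN z u, real_inner_comm (T u) z, real_inner_comm (N u) z]
    ring
  rw [hLx, hnx]
  have : (γ' + 2 * η) * ‖z‖ ^ 2 ≤ (μ - (γm - γ' - 3 * η)) * ‖z‖ ^ 2 := by
    gcongr
    linarith
  linarith

end Operators

open Finset

variable {I : ℕ} {p : Fin I → ℕ}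

/-! ### Frobenius norm and trace inner product -/

section Frobenius

variable {m n : Type*} [Fintype m] [Fintype n]

theorem frob_eq_norm (A : Matrix m n ℝ) :
    frob A = ‖(WithLp.toLp 2 fun q : m × n => A q.1 q.2 : EuclideanSpace ℝ (m × n))‖ := by
  simp [frob, EuclideanSpace.norm_eq, Fintype.sum_prod_type]

theorem frob_nonneg (A : Matrix m n ℝ) : 0 ≤ frob A := Real.sqrt_nonneg _

theorem frob_sq (A : Matrix m n ℝ) : frob A ^ 2 = ∑ i, ∑ j, A i j ^ 2 :=
  Real.sq_sqrt (by positivity)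

theorem frob_add_le (A B : Matrix m n ℝ) : frob (A + B) ≤ frob A + frob B := by
  have h : (WithLp.toLp 2 fun q : m × n => (A + B) q.1 q.2 : EuclideanSpace ℝ (m × n))
      = WithLp.toLp 2 (fun q : m × n => A q.1 q.2) + WithLp.toLp 2 (fun q : m × n => B q.1 q.2) := by
    ext q; simp
  rw [frob_eq_norm, h, frob_eq_norm, frob_eq_norm]
  exact norm_add_le _ _

theorem frob_sub_le (A B : Matrix m n ℝ) : frob (A - B) ≤ frob A + frob B := by
  have h : (WithLp.toLp 2 fun q : m × n => (A - B) q.1 q.2 : EuclideanSpace ℝ (m × n))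
      = WithLp.toLp 2 (fun q : m × n => A q.1 q.2) - WithLp.toLp 2 (fun q : m × n => B q.1 q.2) := by
    ext q; simp
  rw [frob_eq_norm, h, frob_eq_norm, frob_eq_norm]
  exact norm_sub_le _ _

theorem frob_smul (a : ℝ) (A : Matrix m n ℝ) : frob (a • A) = |a| * frob A := by
  have h : (WithLp.toLp 2 fun q : m × n => (a • A) q.1 q.2 : EuclideanSpace ℝ (m × n))
      = a • WithLp.toLp 2 (fun q : m × n => A q.1 q.2) := by
    ext q; simp
  rw [frob_eq_norm, h, frob_eq_norm, norm_smul, Real.norm_eq_abs]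

theorem frob_zero : frob (0 : Matrix m n ℝ) = 0 := by simp [frob]

theorem frob_transpose (A : Matrix m n ℝ) : frob A.transpose = frob A := by
  simp only [frob, Matrix.transpose_apply]
  rw [sum_comm]

theorem frob_vecMulVec (x : EuclideanSpace ℝ m) (y : EuclideanSpace ℝ n) :
    frob (Matrix.vecMulVec x.ofLp y.ofLp) = ‖x‖ * ‖y‖ := by
  rw [← sq_eq_sq₀ (frob_nonneg _) (by positivity), frob_sq, mul_pow, EuclideanSpace.real_norm_sq_eq,
    EuclideanSpace.real_norm_sq_eq, sum_mul_sum]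
  simp [Matrix.vecMulVec_apply, mul_pow]

theorem sum_mul_le_frob_mul_frob (A B : Matrix m n ℝ) :
    ∑ i, ∑ j, A i j * B i j ≤ frob A * frob B := by
  simp only [frob_eq_norm]
  have := real_inner_le_norm (WithLp.toLp 2 fun q : m × n => A q.1 q.2 : EuclideanSpace ℝ (m × n))
    (WithLp.toLp 2 fun q : m × n => B q.1 q.2)
  simpa [PiLp.inner_apply, Fintype.sum_prod_type, mul_comm] using this

theorem norm_mulVec_le_frob (A : Matrix m n ℝ) (x : EuclideanSpace ℝ n) :
    ‖(WithLp.toLp 2 (A.mulVec x.ofLp) : EuclideanSpace ℝ m)‖ ≤ frob A * ‖x‖ := by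
  rw [← sq_le_sq₀ (norm_nonneg _) (mul_nonneg (frob_nonneg _) (norm_nonneg _)), mul_pow, frob_sq,
    EuclideanSpace.real_norm_sq_eq, EuclideanSpace.real_norm_sq_eq, sum_mul]
  refine sum_le_sum fun i _ => ?_
  simpa [Matrix.mulVec, dotProduct] using sum_mul_sq_le_sq_mul_sq univ (A i) x.ofLp

theorem traceInner_eq_sum (A B : Matrix n n ℝ) : traceInner A B = ∑ s, ∑ t, A s t * B s t := by
  simp [traceInner, Matrix.trace, Matrix.mul_apply]

theorem traceInner_add (A B C : Matrix n n ℝ) :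
    traceInner A (B + C) = traceInner A B + traceInner A C := by
  simp [traceInner_eq_sum, mul_add, sum_add_distrib]

theorem traceInner_smul (a : ℝ) (A B : Matrix n n ℝ) :
    traceInner A (a • B) = a * traceInner A B := by
  simp only [traceInner_eq_sum, Matrix.smul_apply, smul_eq_mul, mul_sum]
  exact sum_congr rfl fun _ _ => sum_congr rfl fun _ _ => by ring

theorem sub_traceInner (A B C : Matrix n n ℝ) :
    traceInner (A - B) C = traceInner A C - traceInner B C := by
  simp [traceInner_eq_sum, sub_mul]

theorem traceInner_sum {ι : Type*} (A : Matrix n n ℝ) (s : Finset ι) (B : ι → Matrix n n ℝ) :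
    traceInner A (∑ i ∈ s, B i) = ∑ i ∈ s, traceInner A (B i) := by
  classical
  induction s using Finset.induction_on with
  | empty => simp [traceInner_eq_sum]
  | insert a s ha ih => rw [sum_insert ha, sum_insert ha, traceInner_add, ih]

theorem traceInner_comm (A B : Matrix n n ℝ) : traceInner A B = traceInner B A := by
  simp [traceInner_eq_sum, mul_comm]

end Frobenius

/-! ### Matrices as operators, rank one matrices and the deflated Fantope -/

/-- The operator of a matrix on the Euclidean space. -/
noncomputable def op (A : Mat p) : Vec p →L[ℝ] Vec p := Matrix.toEuclideanCLM (𝕜 := ℝ) A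

theorem op_apply (A : Mat p) (x : Vec p) (s : Coord p) : op A x s = ∑ t, A s t * x t := by
  simp [op, Matrix.mulVec, dotProduct]

theorem op_add (A B : Mat p) : op (A + B) = op A + op B := map_add _ A B

theorem op_sub (A B : Mat p) : op (A - B) = op A - op B := map_sub _ A B

theorem op_smul (a : ℝ) (A : Mat p) : op (a • A) = a • op A := map_smul _ a A

theorem op_sum {ι : Type*} (s : Finset ι) (A : ι → Mat p) :
    op (∑ i ∈ s, A i) = ∑ i ∈ s, op (A i) := map_sum _ A s

theorem inner_eq_sum (x y : Vec p) : inner ℝ x y = ∑ s, x s * y s := by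
  simp [PiLp.inner_apply, mul_comm]

theorem inner_op (A : Mat p) (x y : Vec p) :
    inner ℝ (op A x) y = ∑ s, ∑ t, A s t * (y s * x t) := by
  simp only [inner_eq_sum, op_apply, sum_mul]
  exact sum_congr rfl fun _ _ => sum_congr rfl fun _ _ => by ring

theorem inner_op_transpose (A : Mat p) (x y : Vec p) :
    inner ℝ (op A.transpose x) y = inner ℝ x (op A y) := by
  rw [inner_op, ← real_inner_comm, inner_op, sum_comm]
  simp [mul_comm]

theorem inner_op_symm {A : Mat p} (hA : A.IsSymm) (x y : Vec p) :
    inner ℝ (op A x) y = inner ℝ x (op A y) := by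
  rw [← inner_op_transpose, hA.eq]

theorem norm_op_le_frob (A : Mat p) : ‖op A‖ ≤ frob A := by
  refine ContinuousLinearMap.opNorm_le_bound _ (frob_nonneg A) fun x => ?_
  have h : op A x = WithLp.toLp 2 (A.mulVec x.ofLp) := by
    ext s; simp [op]
  rw [h]
  exact norm_mulVec_le_frob A x

theorem op_outer (x y : Vec p) : op (outer x) y = (inner ℝ x y : ℝ) • x := by
  ext s
  simp only [op_apply, outer, Matrix.of_apply, inner_eq_sum, PiLp.smul_apply, smul_eq_mul, sum_mul]
  exact sum_congr rfl fun _ _ => by ring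

theorem op_projSum (u : ℕ → Vec p) (j : ℕ) (x : Vec p) :
    op (projSum u j) x = ∑ k ∈ Icc 1 j, (inner ℝ (u k) x : ℝ) • u k := by
  simp [projSum, op_sum, op_outer]

theorem outer_smul (a : ℝ) (x : Vec p) : outer (a • x) = a ^ 2 • outer x := by
  ext; simp [outer]; ring

theorem outer_isSymm (x : Vec p) : (outer x).IsSymm := by
  ext; simp [outer, mul_comm]

theorem traceInner_outer (A : Mat p) (x : Vec p) : traceInner A (outer x) = inner ℝ (op A x) x := by
  rw [inner_op, traceInner_eq_sum]; rfl

theorem trace_outer (x : Vec p) : (outer x).trace = ‖x‖ ^ 2 := by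
  rw [EuclideanSpace.real_norm_sq_eq]; simp [Matrix.trace, outer, sq]

theorem posSemidef_outer (x : Vec p) : (outer x).PosSemidef := by
  have := Matrix.posSemidef_vecMulVec_self_star x.ofLp
  rwa [show outer x = Matrix.vecMulVec x.ofLp (star x.ofLp) by
    ext; simp [outer, Matrix.vecMulVec_apply]]

/-- The vectors are the rows of B in H = BᵀB. They need not be orthogonal: the trace becomes a sum
of squared norms and linear functionals become sums of quadratic forms, which suffices for bounds
over the Fantope. -/
theorem exists_sum_outer {H : Mat p} (hH : H.PosSemidef) :
    ∃ h : Coord p → Vec p, H = ∑ i, outer (h i) := by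
  open scoped MatrixOrder in
  obtain ⟨B, rfl⟩ := CStarAlgebra.nonneg_iff_eq_star_mul_self.mp hH.nonneg
  refine ⟨fun i => WithLp.toLp 2 (B i), ?_⟩
  ext s t
  simp [Matrix.mul_apply, Matrix.sum_apply, outer]

theorem one_sub_outer_posSemidef {x : Vec p} (hx : ‖x‖ = 1) : (1 - outer x).PosSemidef := by
  refine .of_dotProduct_mulVec_nonneg ?_ fun y => ?_
  · rw [Matrix.IsHermitian, Matrix.conjTranspose_eq_transpose_of_trivial, Matrix.transpose_sub,
      (outer_isSymm x).eq, Matrix.transpose_one]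
  · have h1 : star y ⬝ᵥ (1 - outer x).mulVec y
        = ‖(WithLp.toLp 2 y : Vec p)‖ ^ 2 - inner ℝ x (WithLp.toLp 2 y) ^ 2 := by
      have h2 := congrArg (fun z : Vec p => (inner ℝ (WithLp.toLp 2 y) z : ℝ))
        (op_outer x (WithLp.toLp 2 y))
      simp only [inner_smul_right, inner_eq_sum, op_apply] at h2
      rw [Matrix.sub_mulVec, dotProduct_sub, EuclideanSpace.real_norm_sq_eq]
      simp only [inner_eq_sum, Matrix.mulVec, dotProduct, star_trivial, Matrix.one_apply]
      rw [h2]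
      simp only [ite_mul, one_mul, zero_mul, sum_ite_eq, mem_univ, if_true]
      congr 1
      · exact sum_congr rfl fun _ _ => by ring
      · rw [sq]; congr 1; exact sum_congr rfl fun _ _ => by ring
    rw [h1]
    have h3 := abs_real_inner_le_norm x (WithLp.toLp 2 y)
    rw [hx, one_mul] at h3
    have := sq_le_sq' (by linarith [neg_abs_le (inner ℝ x (WithLp.toLp 2 y : Vec p) : ℝ)])
      ((le_abs_self _).trans h3)
    linarith

theorem inner_op_outer (x y : Vec p) : inner ℝ (op (outer x) y) y = (inner ℝ x y : ℝ) ^ 2 := by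
  rw [op_outer, inner_smul_left, sq]; simp

/-- Orthogonality to a sum of rank one projections. -/
theorem traceInner_sum_outer_projSum_eq_zero {ι : Type*} [Fintype ι] {h : ι → Vec p}
    {u : ℕ → Vec p} {n : ℕ} :
    traceInner (∑ i, outer (h i)) (projSum u n) = 0 ↔
      ∀ i, ∀ k ∈ Icc 1 n, (inner ℝ (u k) (h i) : ℝ) = 0 := by
  have key : traceInner (∑ i, outer (h i)) (projSum u n)
      = ∑ i, ∑ k ∈ Icc 1 n, (inner ℝ (u k) (h i) : ℝ) ^ 2 := by
    rw [traceInner_comm, traceInner_sum]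
    refine sum_congr rfl fun i _ => ?_
    rw [traceInner_comm, projSum, traceInner_sum]
    refine sum_congr rfl fun k _ => ?_
    rw [traceInner_outer, inner_op_outer, real_inner_comm]
  rw [key, sum_eq_zero_iff_of_nonneg fun i _ => by positivity]
  constructor
  · intro hz i k hk
    have := (sum_eq_zero_iff_of_nonneg fun k _ => by positivity).1 (hz i (mem_univ i)) k hk
    simpa using this
  · intro hz i _
    exact sum_eq_zero fun k hk => by rw [hz i k hk]; simp

theorem outer_mem_deflatedFantope {x : Vec p} {u : ℕ → Vec p} {n : ℕ} (hx : ‖x‖ = 1)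
    (hu : ∀ k ∈ Icc 1 n, (inner ℝ (u k) x : ℝ) = 0) :
    outer x ∈ deflatedFantope (projSum u n) := by
  refine ⟨posSemidef_outer x, one_sub_outer_posSemidef hx, by rw [trace_outer, hx]; norm_num, ?_⟩
  have := (traceInner_sum_outer_projSum_eq_zero (ι := Unit) (h := fun _ => x) (u := u) (n := n)).2
    fun _ => hu
  simpa using this

/-- A quadratic form with a spectral gap is uniquely maximized over the deflated Fantope. -/
theorem traceInner_le_of_gap {A : Mat p} {x : Vec p} {u : ℕ → Vec p} {n : ℕ} {μ κ : ℝ}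
    (hx : ‖x‖ = 1) (hκ : 0 < κ)
    (hA : ∀ y : Vec p, (∀ k ∈ Icc 1 n, (inner ℝ (u k) y : ℝ) = 0) →
      inner ℝ (op A y) y ≤ μ * ‖y‖ ^ 2 - κ * ‖y - (inner ℝ x y : ℝ) • x‖ ^ 2)
    {H : Mat p} (hH : H ∈ deflatedFantope (projSum u n)) :
    traceInner A H ≤ μ ∧ (μ ≤ traceInner A H → H = outer x) := by
  obtain ⟨hH1, -, hH3, hH4⟩ := hH
  obtain ⟨h, rfl⟩ := exists_sum_outer hH1
  rw [traceInner_sum_outer_projSum_eq_zero] at hH4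
  have htr : ∑ i, ‖h i‖ ^ 2 = 1 := by
    rw [← hH3, Matrix.trace_sum]; simp [trace_outer]
  obtain ⟨d, hd⟩ : ∃ d : Coord p → ℝ, ∀ i, d i = ‖h i - (inner ℝ x (h i) : ℝ) • x‖ :=
    ⟨_, fun _ => rfl⟩
  have hle : traceInner A (∑ i, outer (h i)) ≤ μ - κ * ∑ i, d i ^ 2 := by
    calc traceInner A (∑ i, outer (h i)) = ∑ i, inner ℝ (op A (h i)) (h i) := by
          rw [traceInner_sum]
          exact sum_congr rfl fun i _ => traceInner_outer A (h i)
      _ ≤ ∑ i, (μ * ‖h i‖ ^ 2 - κ * d i ^ 2) :=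
          sum_le_sum fun i _ => by rw [hd]; exact hA _ (hH4 i)
      _ = μ * ∑ i, ‖h i‖ ^ 2 - κ * ∑ i, d i ^ 2 := by
          rw [sum_sub_distrib, ← mul_sum, ← mul_sum]
      _ = _ := by rw [htr, mul_one]
  have hnn : 0 ≤ ∑ i, d i ^ 2 := sum_nonneg fun i _ => sq_nonneg (d i)
  refine ⟨hle.trans (sub_le_self _ (mul_nonneg hκ.le hnn)), fun hge => ?_⟩
  -- Attaining `μ` leaves no room for components orthogonal to `x`, so every `h i` is a multiple of
  -- `x`.
  have hz : ∑ i, d i ^ 2 = 0 := by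
    by_contra hne
    have := mul_pos hκ (lt_of_le_of_ne hnn (Ne.symm hne))
    linarith
  rw [sum_eq_zero_iff_of_nonneg fun i _ => sq_nonneg (d i)] at hz
  have hi : ∀ i, h i = (inner ℝ x (h i) : ℝ) • x := fun i => by
    have := pow_eq_zero_iff two_ne_zero |>.1 (hz i (mem_univ i))
    rw [hd] at this
    exact sub_eq_zero.1 (norm_eq_zero.1 this)
  have hsum : ∑ i, (inner ℝ x (h i) : ℝ) ^ 2 = 1 := by
    rw [← htr]
    refine sum_congr rfl fun i _ => ?_
    conv_rhs => rw [hi i]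
    rw [norm_smul, hx, mul_one, Real.norm_eq_abs, sq_abs]
  calc ∑ i, outer (h i) = ∑ i, (inner ℝ x (h i) : ℝ) ^ 2 • outer x :=
        sum_congr rfl fun i _ => by rw [← outer_smul, ← hi i]
    _ = outer x := by rw [← sum_smul, hsum, one_smul]

/-- The leading eigenvectors of `x xᵀ` are `x` and `-x`. -/
theorem isLeadingEigenvector_outer {x : Vec p} (hx : ‖x‖ = 1) (y : Vec p) :
    IsLeadingEigenvector (outer x) y ↔ y = x ∨ y = -x := by
  have happ : ∀ z : Coord p → ℝ, Matrix.toLin' (outer x) z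
      = (inner ℝ x (WithLp.toLp 2 z : Vec p) : ℝ) • x.ofLp := by
    intro z
    exact congrArg WithLp.ofLp (op_outer x (WithLp.toLp 2 z))
  have hxx : (inner ℝ x x : ℝ) = 1 := by rw [real_inner_self_eq_norm_sq, hx]; norm_num
  have hx0 : x.ofLp ≠ 0 := by
    intro h
    have : x = 0 := by ext s; simp [h]
    simp [this] at hx
  have hev : Module.End.HasEigenvector (Matrix.toLin' (outer x)) 1 x.ofLp := by
    refine ⟨Module.End.mem_eigenspace_iff.2 ?_, hx0⟩
    rw [happ]; simp [hx]
  constructor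
  · rintro ⟨hy, μ, ⟨hμ1, hμ2⟩, hμ3⟩
    -- Maximality is used only to make `μ` nonzero, which forces `y` to be parallel to `x`.
    have h1 : 1 ≤ μ := hμ3 1 (Module.End.hasEigenvalue_of_hasEigenvector hev)
    rw [Module.End.mem_eigenspace_iff, happ] at hμ1
    have h2 : (inner ℝ x y : ℝ) • x = μ • y := by ext s; exact congrFun hμ1 s
    have h3 : y = (μ⁻¹ * inner ℝ x y) • x := by
      rw [mul_smul, h2, inv_smul_smul₀ (by linarith)]
    have h4 : |μ⁻¹ * inner ℝ x y| = 1 := by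
      rw [h3, norm_smul, hx, mul_one] at hy
      simpa using hy
    rcases eq_or_eq_neg_of_abs_eq h4 with h | h
    · left; rw [h3, h, one_smul]
    · right; rw [h3, h, neg_one_smul]
  · intro hy
    have hmax : ∀ ν : ℝ, Module.End.HasEigenvalue (Matrix.toLin' (outer x)) ν → ν ≤ 1 := by
      intro ν hν
      obtain ⟨z, hz1, hz2⟩ := hν.exists_hasEigenvector
      rw [Module.End.mem_eigenspace_iff, happ] at hz1
      have h2 : (inner ℝ x (WithLp.toLp 2 z : Vec p) : ℝ) • x = ν • (WithLp.toLp 2 z : Vec p) := by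
        ext s; exact congrFun hz1 s
      have h3 := congrArg (fun a => (inner ℝ x a : ℝ)) h2
      simp only [inner_smul_right, hxx, mul_one] at h3
      by_contra hc
      push Not at hc
      have h4 : (inner ℝ x (WithLp.toLp 2 z : Vec p) : ℝ) = 0 := by
        by_contra h0
        exact hc.ne (mul_right_cancel₀ h0 (by linarith))
      rw [h4, zero_smul] at h2
      rcases smul_eq_zero.1 h2.symm with h | h
      · linarith
      · exact hz2 (congrArg WithLp.ofLp h)
    rcases hy with rfl | rfl
    · exact ⟨hx, 1, hev, hmax⟩
    · refine ⟨by simpa, 1, ⟨?_, by simpa using hx0⟩, hmax⟩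
      exact Submodule.neg_mem _ hev.1


/-! ### Subgradients from Hahn–Banach separation -/

/-- At a maximizer of a linear functional minus a sublinear function over a compact convex set, the
sublinear function has a subgradient for which the maximizer solves the linearized problem. -/
theorem exists_max_and_subgradient {E : Type*} [TopologicalSpace E] [AddCommGroup E] [Module ℝ E]
    [IsTopologicalAddGroup E] [ContinuousSMul ℝ E] {K : Set E} (hKc : IsCompact K)
    (hKv : Convex ℝ K) (hKn : K.Nonempty) (f : E →ₗ[ℝ] ℝ) (hf : Continuous f) {φ : E → ℝ}
    (hφ : Continuous φ) (hφv : ConvexOn ℝ Set.univ φ)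
    (hφh : ∀ t : ℝ, 0 ≤ t → ∀ x, φ (t • x) = t * φ x) :
    ∃ H ∈ K, ∃ y : E →ₗ[ℝ] ℝ, (∀ x, y x ≤ φ x) ∧ y H = φ H ∧ ∀ x ∈ K, f x - y x ≤ f H - y H := by
  obtain ⟨H, hH, hmax⟩ := hKc.exists_isMaxOn hKn (f := fun x => f x - φ x) (by fun_prop)
  -- The strict epigraph of `φ` is separated from the hypograph of `f` over `K`, shifted to touch
  -- `φ` at `H`; their disjointness is the optimality of `H`.
  have hA : Convex ℝ {q : E × ℝ | φ q.1 < q.2} := by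
    simpa using hφv.convex_strict_epigraph
  have hAo : IsOpen {q : E × ℝ | φ q.1 < q.2} :=
    isOpen_lt (hφ.comp continuous_fst) continuous_snd
  have hB : Convex ℝ {q : E × ℝ | q.1 ∈ K ∧ q.2 ≤ f q.1 - (f H - φ H)} := by
    have hf' : ConcaveOn ℝ K f := f.concaveOn hKv
    have hc : ConcaveOn ℝ K fun x => f x - (f H - φ H) := by
      simp only [sub_eq_add_neg (f _) (f H - φ H)]
      exact hf'.add_const (-(f H - φ H))
    exact hc.convex_hypograph
  have hdisj : Disjoint {q : E × ℝ | φ q.1 < q.2}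
      {q : E × ℝ | q.1 ∈ K ∧ q.2 ≤ f q.1 - (f H - φ H)} := by
    rw [Set.disjoint_left]
    rintro ⟨x, t⟩ h1 ⟨h2, h3⟩
    have h4 : f x - φ x ≤ f H - φ H := hmax h2
    have h1' : φ x < t := h1
    have h3' : t ≤ f x - (f H - φ H) := h3
    linarith
  obtain ⟨F, u, hF1, hF2⟩ := geometric_hahn_banach_open hA hAo hB hdisj
  have hFd : ∀ x t, F (x, t) = F (x, 0) + t * F (0, 1) := by
    intro x t
    rw [← smul_eq_mul, ← map_smul, ← map_add]
    simp
  set τ := F (0, 1) with hτd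
  have hFA : ∀ x t, φ x < t → F (x, 0) + t * τ < u := fun x t h => by
    rw [← hFd]; exact hF1 (x, t) h
  have hFB : ∀ x ∈ K, u ≤ F (x, 0) + (f x - (f H - φ H)) * τ := fun x h => by
    rw [← hFd]; exact hF2 (x, _) ⟨h, le_rfl⟩
  -- The separating hyperplane is not vertical, because both sets contain points above `H`.
  have hτ : τ < 0 := by
    have h1 := hFA H (φ H + 1) (by linarith)
    have h2 := hFB H hH
    linarith
  have hFA' : ∀ x, F (x, 0) + φ x * τ ≤ u := by
    intro x
    by_contra hc
    push Not at hc
    have h1 := hFA x (φ x + (F (x, 0) + φ x * τ - u) / (-τ))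
      (by linarith [div_pos (sub_pos.2 hc) (neg_pos.2 hτ)])
    have h2 : (F (x, 0) + φ x * τ - u) / (-τ) * τ = -(F (x, 0) + φ x * τ - u) := by
      field_simp [hτ.ne]
    linarith
  let y : E →ₗ[ℝ] ℝ := (-τ)⁻¹ • (F.toLinearMap ∘ₗ LinearMap.inl ℝ E ℝ)
  have hy : ∀ x, y x = (-τ)⁻¹ * F (x, 0) := fun x => rfl
  have hyF : ∀ x, F (x, 0) = y x * (-τ) := fun x => by
    rw [hy]; field_simp [hτ.ne]
  have hφ0 : φ 0 = 0 := by simpa using hφh 0 le_rfl 0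
  have hu0 : 0 ≤ u := by
    have := hFA' 0
    rw [hyF, map_zero, hφ0] at this
    linarith
  have hyφ : ∀ x, y x ≤ φ x := by
    intro x
    by_contra hc
    push Not at hc
    have hpos : 0 < (y x - φ x) * (-τ) := mul_pos (by linarith) (by linarith)
    -- By homogeneity a violation of `y x ≤ φ x` can be scaled until the left side of `hFA'` equals
    -- `u + 1`; `hu0` makes the scaling factor nonnegative.
    have h1 := hFA' (((u + 1) / ((y x - φ x) * (-τ))) • x)
    rw [hyF, map_smul, hφh _ (by positivity), smul_eq_mul] at h1
    have h2 : (u + 1) / ((y x - φ x) * (-τ)) * y x * (-τ)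
        + (u + 1) / ((y x - φ x) * (-τ)) * φ x * τ = u + 1 := by
      have : (u + 1) / ((y x - φ x) * (-τ)) * ((y x - φ x) * (-τ)) = u + 1 :=
        div_mul_cancel₀ _ hpos.ne'
      linarith
    linarith
  have hyH : y H = φ H := by
    refine le_antisymm (hyφ H) ?_
    have h1 := hFB H hH
    rw [hyF] at h1
    have h2 : 0 ≤ (y H - φ H) * (-τ) := by linarith
    have := nonneg_of_mul_nonneg_left h2 (neg_pos.2 hτ)
    linarith
  refine ⟨H, hH, y, hyφ, hyH, fun x hx => ?_⟩
  have h1 := hFB x hx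
  rw [hyF] at h1
  have h2 : 0 ≤ (y x - (f x - (f H - φ H))) * (-τ) := by linarith
  have := nonneg_of_mul_nonneg_left h2 (neg_pos.2 hτ)
  linarith

/-! ### The group penalty and its dual norm -/

section Penalty

variable {w : Fin I → Fin I → ℝ}

theorem block_add (A B : Mat p) (k l : Fin I) : block (A + B) k l = block A k l + block B k l := rfl

theorem block_sub (A B : Mat p) (k l : Fin I) : block (A - B) k l = block A k l - block B k l := rfl

theorem block_smul (a : ℝ) (A : Mat p) (k l : Fin I) : block (a • A) k l = a • block A k l := rfl

theorem block_transpose (A : Mat p) (k l : Fin I) :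
    block A.transpose k l = (block A l k).transpose := rfl

theorem continuous_frob_block (k l : Fin I) : Continuous fun H : Mat p => frob (block H k l) := by
  unfold frob block
  simp only [Matrix.of_apply]
  fun_prop

theorem continuous_groupPenalty : Continuous (groupPenalty (p := p) w) :=
  continuous_finsetSum _ fun k _ => continuous_finsetSum _ fun l _ =>
    (continuous_frob_block k l).const_mul _

theorem groupPenalty_smul {t : ℝ} (ht : 0 ≤ t) (H : Mat p) :
    groupPenalty w (t • H) = t * groupPenalty w H := by
  simp only [groupPenalty, block_smul, frob_smul, abs_of_nonneg ht, mul_sum]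
  exact sum_congr rfl fun _ _ => sum_congr rfl fun _ _ => by ring

theorem groupPenalty_add_le (hw : ∀ k l, 0 < w k l) (A B : Mat p) :
    groupPenalty w (A + B) ≤ groupPenalty w A + groupPenalty w B := by
  simp only [groupPenalty, ← sum_add_distrib, ← mul_add, block_add]
  exact sum_le_sum fun k _ => sum_le_sum fun l _ =>
    mul_le_mul_of_nonneg_left (frob_add_le _ _) (hw k l).le

theorem objective_zero (S : Mat p) (lam : ℝ) (H : Mat p) :
    objective S lam 0 w H = traceInner S H - lam * groupPenalty w H := by
  simp [objective]

theorem sum_coord (f : Coord p → ℝ) : ∑ s, f s = ∑ k, ∑ a, f ⟨k, a⟩ := by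
  rw [← univ_sigma_univ, sum_sigma]

theorem traceInner_eq_sum_block (A B : Mat p) :
    traceInner A B = ∑ k, ∑ l, ∑ a, ∑ b, block A k l a b * block B k l a b := by
  rw [traceInner_eq_sum, sum_coord]
  refine sum_congr rfl fun k _ => ?_
  rw [sum_comm' (t' := univ) (s' := fun _ => univ) (by simp)]
  rw [sum_coord]
  refine sum_congr rfl fun l _ => ?_
  rw [sum_comm]
  rfl

/-- The dual norm inequality for the group norm. -/
theorem traceInner_le_groupPenalty {lam : ℝ} {Y : Mat p}
    (hY : ∀ k l, frob (block Y k l) ≤ lam * w k l) (H : Mat p) :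
    traceInner Y H ≤ lam * groupPenalty w H := by
  rw [traceInner_eq_sum_block, groupPenalty, mul_sum]
  refine sum_le_sum fun k _ => ?_
  rw [mul_sum]
  refine sum_le_sum fun l _ => (sum_mul_le_frob_mul_frob _ _).trans ?_
  rw [← mul_assoc]
  exact mul_le_mul_of_nonneg_right (hY k l) (frob_nonneg _)

/-- The matrix that keeps one block. -/
def keepBlock (A : Mat p) (k l : Fin I) : Mat p :=
  Matrix.of fun s t => if s.1 = k ∧ t.1 = l then A s t else 0

theorem block_keepBlock (A : Mat p) (k l k' l' : Fin I) :
    block (keepBlock A k l) k' l' = if k' = k ∧ l' = l then block A k' l' else 0 := by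
  ext a b
  by_cases h : k' = k ∧ l' = l <;> simp [block, keepBlock, h]

/-- Testing the inequality on the single block `(k, l)` of `Y` itself gives the converse of
`traceInner_le_groupPenalty`. -/
theorem frob_block_le_of_subgradient {lam : ℝ} {Y : Mat p}
    (hY : ∀ H, traceInner Y H ≤ lam * groupPenalty w H) (hlam : 0 ≤ lam)
    (hw : ∀ k l, 0 < w k l) (k l : Fin I) : frob (block Y k l) ≤ lam * w k l := by
  have h := hY (keepBlock Y k l)
  have h1 : traceInner Y (keepBlock Y k l) = frob (block Y k l) ^ 2 := by
    rw [traceInner_eq_sum_block, sum_eq_single k, sum_eq_single l, frob_sq, block_keepBlock]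
    · simp [sq]
    · intro l' _ hl'; simp [block_keepBlock, hl']
    · simp
    · intro k' _ hk'; simp [block_keepBlock, hk']
    · simp
  have h2 : groupPenalty w (keepBlock Y k l) = w k l * frob (block Y k l) := by
    rw [groupPenalty, sum_eq_single k, sum_eq_single l, block_keepBlock]
    · simp
    · intro l' _ hl'; simp [block_keepBlock, hl', frob_zero]
    · simp
    · intro k' _ hk'; simp [block_keepBlock, hk', frob_zero]
    · simp
  rw [h1, h2] at h
  rcases (frob_nonneg (block Y k l)).eq_or_lt with h0 | h0
  · rw [← h0]; exact mul_nonneg hlam (hw k l).le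
  · refine le_of_mul_le_mul_right ?_ h0
    nlinarith

end Penalty

/-! ### The support-restricted problem and its dual certificate -/

/-- The elements of the deflated Fantope whose support lies in `J × J`. -/
def restrictedFantope (P : Mat p) (J : Finset (Fin I)) : Set (Mat p) :=
  {H | H ∈ deflatedFantope P ∧ ∀ s t : Coord p, ¬(s.1 ∈ J ∧ t.1 ∈ J) → H s t = 0}

theorem convex_restrictedFantope (P : Mat p) (J : Finset (Fin I)) :
    Convex ℝ (restrictedFantope P J) := by
  rintro A ⟨⟨hA1, hA2, hA3, hA4⟩, hA5⟩ B ⟨⟨hB1, hB2, hB3, hB4⟩, hB5⟩ a b ha hb hab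
  refine ⟨⟨(hA1.smul ha).add (hB1.smul hb), ?_, ?_, ?_⟩, fun s t h => ?_⟩
  · have : 1 - (a • A + b • B) = a • (1 - A) + b • (1 - B) := by
      rw [smul_sub, smul_sub, sub_add_sub_comm, ← add_smul, hab, one_smul]
    rw [this]
    exact (hA2.smul ha).add (hB2.smul hb)
  · simp [Matrix.trace_add, Matrix.trace_smul, hA3, hB3, hab]
  · rw [traceInner_comm, traceInner_add, traceInner_smul, traceInner_smul, traceInner_comm P A,
      traceInner_comm P B, hA4, hB4]
    simp
  · simp [hA5 s t h, hB5 s t h]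

theorem isClosed_posSemidef : IsClosed {H : Mat p | H.PosSemidef} := by
  simp only [Matrix.posSemidef_iff_dotProduct_mulVec, Set.ofPred_and, Set.ofPred_forall]
  refine IsClosed.inter ?_ (isClosed_iInter fun x => ?_)
  · exact isClosed_eq (by fun_prop) continuous_id
  · exact isClosed_le continuous_const (by fun_prop)

theorem abs_le_one_of_mem_deflatedFantope {P H : Mat p} (hH : H ∈ deflatedFantope P)
    (s t : Coord p) : |H s t| ≤ 1 := by
  obtain ⟨hH1, -, hH3, -⟩ := hH
  obtain ⟨h, rfl⟩ := exists_sum_outer hH1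
  have htr : ∑ i, ‖h i‖ ^ 2 = 1 := by
    rw [← hH3, Matrix.trace_sum]
    exact sum_congr rfl fun i _ => (trace_outer (h i)).symm
  rw [Matrix.sum_apply, ← htr]
  refine (abs_sum_le_sum_abs _ _).trans (sum_le_sum fun i _ => ?_)
  rw [outer, Matrix.of_apply, abs_mul, sq]
  exact mul_le_mul (PiLp.norm_apply_le (h i) s) (PiLp.norm_apply_le (h i) t) (abs_nonneg _)
    (norm_nonneg _)

theorem continuous_traceInner (A : Mat p) : Continuous fun H : Mat p => traceInner A H := by
  simp only [traceInner_eq_sum]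
  fun_prop

theorem isCompact_restrictedFantope (P : Mat p) (J : Finset (Fin I)) :
    IsCompact (restrictedFantope P J) := by
  have hbox : IsCompact (Set.univ.pi fun _ : Coord p => Set.univ.pi fun _ : Coord p =>
      Set.Icc (-1 : ℝ) 1) :=
    isCompact_univ_pi fun _ => isCompact_univ_pi fun _ => isCompact_Icc
  refine IsCompact.of_isClosed_subset hbox ?_ fun H hH s _ t _ =>
    abs_le.1 (abs_le_one_of_mem_deflatedFantope hH.1 s t)
  have h1 : IsClosed {H : Mat p | (1 - H).PosSemidef} :=
    isClosed_posSemidef.preimage (continuous_const.sub continuous_id)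
  have h2 : IsClosed {H : Mat p | H.trace = 1} :=
    isClosed_eq (by fun_prop) continuous_const
  have h3 : IsClosed {H : Mat p | traceInner H P = 0} := by
    simp only [traceInner_comm _ P]
    exact isClosed_eq (continuous_traceInner P) continuous_const
  have h4 : IsClosed {H : Mat p | ∀ s t : Coord p, ¬(s.1 ∈ J ∧ t.1 ∈ J) → H s t = 0} := by
    simp only [Set.ofPred_forall]
    exact isClosed_iInter fun s => isClosed_iInter fun t => isClosed_iInter fun _ =>
      isClosed_eq (by fun_prop) continuous_const
  exact (isClosed_posSemidef.inter (h1.inter (h2.inter h3))).inter h4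

/-- A solution of the support-restricted problem together with a dual certificate. -/
theorem exists_restricted_solution {w : Fin I → Fin I → ℝ} (hw : ∀ k l, 0 < w k l) {lam : ℝ}
    (hlam : 0 ≤ lam) (S : Mat p) {P : Mat p} {J : Finset (Fin I)}
    (hne : (restrictedFantope P J).Nonempty) :
    ∃ H ∈ restrictedFantope P J, ∃ Y : Mat p, (∀ k l, frob (block Y k l) ≤ lam * w k l) ∧
      traceInner Y H = lam * groupPenalty w H ∧
      ∀ X ∈ restrictedFantope P J, traceInner (S - Y) X ≤ traceInner (S - Y) H := by
  let f : Mat p →ₗ[ℝ] ℝ :=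
    { toFun := traceInner S
      map_add' := traceInner_add S
      map_smul' := fun a => traceInner_smul a S }
  obtain ⟨H, hH, y, hy1, hy2, hy3⟩ := exists_max_and_subgradient
    (isCompact_restrictedFantope P J) (convex_restrictedFantope P J) hne f
    (continuous_traceInner S) (φ := fun H => lam * groupPenalty w H)
    (continuous_groupPenalty.const_mul lam)
    ⟨convex_univ, fun A _ B _ a b ha hb _ => by
      have h1 := groupPenalty_add_le hw (a • A) (b • B)
      rw [groupPenalty_smul ha, groupPenalty_smul hb] at h1
      have := mul_le_mul_of_nonneg_left h1 hlam
      simp only [smul_eq_mul]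
      linarith⟩
    (fun t ht x => by rw [groupPenalty_smul ht]; ring)
  -- The subgradient is represented by its values on elementary matrices. The representing matrix
  -- need not be symmetric, which is why `symmPart` is used later.
  have hyY : ∀ X, y X = traceInner (Matrix.of fun s t => y (Matrix.single s t 1)) X := by
    intro X
    conv_lhs => rw [Matrix.matrix_eq_sum_single X]
    simp only [map_sum, traceInner_eq_sum, Matrix.of_apply]
    refine sum_congr rfl fun s _ => sum_congr rfl fun t _ => ?_
    have : Matrix.single s t (X s t) = X s t • Matrix.single s t (1 : ℝ) := by
      rw [Matrix.smul_single, smul_eq_mul, mul_one]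
    rw [this, map_smul, smul_eq_mul, mul_comm]
  refine ⟨H, hH, Matrix.of fun s t => y (Matrix.single s t 1), ?_, by rw [← hyY, hy2], ?_⟩
  · exact frob_block_le_of_subgradient (fun X => by rw [← hyY]; exact hy1 X) hlam hw
  · intro X hX
    rw [sub_traceInner, sub_traceInner, ← hyY, ← hyY]
    exact hy3 X hX


/-! ### Orthonormal families and deflation operators -/

section OrthonormalFamily

variable {u : ℕ → Vec p} {n : ℕ}
  (hu : ∀ j ∈ Icc 1 n, ∀ k ∈ Icc 1 n, inner ℝ (u j) (u k) = if j = k then (1 : ℝ) else 0)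
include hu

theorem norm_eq_one_of_orthonormal {j : ℕ} (hj : j ∈ Icc 1 n) : ‖u j‖ = 1 := by
  have := hu j hj j hj
  rw [if_pos rfl, real_inner_self_eq_norm_sq] at this
  exact (pow_eq_one_iff_of_nonneg (norm_nonneg _) two_ne_zero).1 this

theorem inner_sum_smul {s : Finset ℕ} (hs : s ⊆ Icc 1 n) (a : ℕ → ℝ) {j : ℕ} (hj : j ∈ Icc 1 n) :
    (inner ℝ (u j) (∑ k ∈ s, a k • u k) : ℝ) = if j ∈ s then a j else 0 := by
  rw [inner_sum]
  simp only [inner_smul_right]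
  rw [← sum_ite_eq s j a]
  refine sum_congr rfl fun k hk => ?_
  rw [hu j hj k (hs hk)]; simp

theorem norm_sq_sum_smul {s : Finset ℕ} (hs : s ⊆ Icc 1 n) (a : ℕ → ℝ) :
    ‖∑ k ∈ s, a k • u k‖ ^ 2 = ∑ k ∈ s, a k ^ 2 := by
  rw [← real_inner_self_eq_norm_sq, sum_inner]
  refine sum_congr rfl fun j hj => ?_
  rw [inner_smul_left, inner_sum_smul hu hs a (hs hj), if_pos hj, sq]
  simp

theorem norm_sq_sub_sum_inner {s : Finset ℕ} (hs : s ⊆ Icc 1 n) (x : Vec p) :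
    ‖x - ∑ k ∈ s, (inner ℝ (u k) x : ℝ) • u k‖ ^ 2
      = ‖x‖ ^ 2 - ∑ k ∈ s, (inner ℝ (u k) x : ℝ) ^ 2 := by
  rw [norm_sub_sq_real, norm_sq_sum_smul hu hs, inner_sum]
  have : ∑ k ∈ s, (inner ℝ x ((inner ℝ (u k) x : ℝ) • u k) : ℝ)
      = ∑ k ∈ s, (inner ℝ (u k) x : ℝ) ^ 2 :=
    sum_congr rfl fun k _ => by rw [inner_smul_right, real_inner_comm, sq]
  rw [this]; ring

theorem sum_inner_sq_le {s : Finset ℕ} (hs : s ⊆ Icc 1 n) (x : Vec p) :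
    ∑ k ∈ s, (inner ℝ (u k) x : ℝ) ^ 2 ≤ ‖x‖ ^ 2 := by
  have := norm_sq_sub_sum_inner hu hs x
  linarith [sq_nonneg ‖x - ∑ k ∈ s, (inner ℝ (u k) x : ℝ) • u k‖]

theorem norm_sum_weighted_le {s : Finset ℕ} (hs : s ⊆ Icc 1 n) {γ : ℕ → ℝ} {c : ℝ} (hc : 0 ≤ c)
    (hγ : ∀ j ∈ s, 0 ≤ γ j ∧ γ j ≤ c) (x : Vec p) :
    ‖∑ j ∈ s, (γ j * inner ℝ (u j) x) • u j‖ ≤ c * ‖x‖ := by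
  rw [← sq_le_sq₀ (norm_nonneg _) (by positivity), norm_sq_sum_smul hu hs, mul_pow]
  calc ∑ j ∈ s, (γ j * (inner ℝ (u j) x : ℝ)) ^ 2
      ≤ ∑ j ∈ s, c ^ 2 * (inner ℝ (u j) x : ℝ) ^ 2 := by
        refine sum_le_sum fun j hj => ?_
        rw [mul_pow]
        exact mul_le_mul_of_nonneg_right (pow_le_pow_left₀ (hγ j hj).1 (hγ j hj).2 2) (sq_nonneg _)
    _ ≤ c ^ 2 * ‖x‖ ^ 2 := by
        rw [← mul_sum]
        exact mul_le_mul_of_nonneg_left (sum_inner_sq_le hu hs x) (sq_nonneg _)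

end OrthonormalFamily

/-- The deflation operator `I - ∑_{k ≤ n} u_k u_kᵀ`. -/
noncomputable def deflation (u : ℕ → Vec p) (n : ℕ) : Vec p →L[ℝ] Vec p := 1 - op (projSum u n)

theorem deflation_apply (u : ℕ → Vec p) (n : ℕ) (x : Vec p) :
    deflation u n x = x - ∑ k ∈ Icc 1 n, (inner ℝ (u k) x : ℝ) • u k := by
  rw [deflation, _root_.sub_apply, op_projSum]; rfl

theorem deflation_symm (u : ℕ → Vec p) (n : ℕ) (x y : Vec p) :
    inner ℝ (deflation u n x) y = inner ℝ x (deflation u n y) := by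
  rw [deflation_apply, deflation_apply, inner_sub_left, inner_sub_right, sum_inner, inner_sum]
  congr 1
  refine sum_congr rfl fun k _ => ?_
  rw [inner_smul_left, inner_smul_right, real_inner_comm x (u k), mul_comm]
  simp

theorem deflation_eq_self {u : ℕ → Vec p} {n : ℕ} {x : Vec p}
    (h : ∀ k ∈ Icc 1 n, (inner ℝ (u k) x : ℝ) = 0) : deflation u n x = x := by
  rw [deflation_apply, sum_eq_zero fun k hk => by rw [h k hk, zero_smul], sub_zero]

theorem inner_deflation {u : ℕ → Vec p} {n r : ℕ} (hnr : n ≤ r)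
    (hu : ∀ j ∈ Icc 1 r, ∀ k ∈ Icc 1 r, inner ℝ (u j) (u k) = if j = k then (1 : ℝ) else 0)
    (x : Vec p) {j : ℕ} (hj : j ∈ Icc 1 r) :
    (inner ℝ (u j) (deflation u n x) : ℝ) = if j ∈ Icc 1 n then 0 else inner ℝ (u j) x := by
  rw [deflation_apply, inner_sub_right,
    inner_sum_smul hu (Icc_subset_Icc_right hnr) (fun k => inner ℝ (u k) x) hj]
  split_ifs <;> simp

section

variable {u : ℕ → Vec p} {n : ℕ}
  (hu : ∀ j ∈ Icc 1 n, ∀ k ∈ Icc 1 n, inner ℝ (u j) (u k) = if j = k then (1 : ℝ) else 0)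
include hu

theorem deflation_idem (x : Vec p) : deflation u n (deflation u n x) = deflation u n x :=
  deflation_eq_self fun k hk => by rw [inner_deflation le_rfl hu x hk, if_pos hk]

theorem inner_eq_zero_of_deflation_eq_self {x : Vec p} (hx : deflation u n x = x) {k : ℕ}
    (hk : k ∈ Icc 1 n) : (inner ℝ (u k) x : ℝ) = 0 := by
  rw [← hx, inner_deflation le_rfl hu x hk, if_pos hk]

theorem norm_deflation_le : ‖deflation u n‖ ≤ 1 := by
  refine ContinuousLinearMap.opNorm_le_bound _ zero_le_one fun x => ?_
  rw [one_mul, ← sq_le_sq₀ (norm_nonneg _) (norm_nonneg _), deflation_apply,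
    norm_sq_sub_sum_inner hu subset_rfl]
  linarith [sum_nonneg fun k (_ : k ∈ Icc 1 n) => sq_nonneg (inner ℝ (u k) x : ℝ)]

end

theorem norm_deflation_sub_deflation_le (v vh : ℕ → Vec p) (n : ℕ) :
    ‖deflation vh n - deflation v n‖ ≤ eps v vh n := by
  have h : deflation vh n - deflation v n = op (projSum v n - projSum vh n) := by
    rw [deflation, deflation, op_sub]; abel
  rw [h, eps]
  split_ifs with h0
  · subst h0
    refine (norm_op_le_frob _).trans ?_
    simp [projSum, frob]
  · exact (norm_op_le_frob _).trans (le_max_left _ _)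

theorem eps_nonneg (v vh : ℕ → Vec p) (n : ℕ) : 0 ≤ eps v vh n :=
  (norm_nonneg _).trans (norm_deflation_sub_deflation_le v vh n)

/-! ### Spectral properties of the signal matrix after deflation -/

namespace IsSignal

variable {Sig : Mat p} {r : ℕ} {γ : ℕ → ℝ} {v : ℕ → Vec p} (hSig : IsSignal Sig r γ v)
include hSig

theorem isSymm : Sig.IsSymm := by
  rw [hSig.eq_sum, Matrix.IsSymm, Matrix.transpose_sum]
  exact sum_congr rfl fun j _ => by rw [Matrix.transpose_smul, (outer_isSymm (v j)).eq]

theorem op_apply (x : Vec p) :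
    op Sig x = ∑ j ∈ Icc 1 r, (γ j * inner ℝ (v j) x) • v j := by
  rw [hSig.eq_sum, op_sum]
  simp [op_smul, op_outer, mul_smul]

theorem next_nonneg {m : ℕ} (hm : m ∈ Icc 1 r) : 0 ≤ γ (m + 1) := by
  rw [mem_Icc] at hm
  rcases hm.2.eq_or_lt with h | h
  · rw [h, hSig.next_eq_zero]
  · exact (hSig.pos (m + 1) (mem_Icc.2 ⟨by omega, h⟩)).le

theorem gap_pos {m : ℕ} (hm : m ∈ Icc 1 r) : γ (m + 1) < γ m := by
  have hm' := mem_Icc.1 hm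
  rcases hm'.2.eq_or_lt with h | h
  · rw [h, hSig.next_eq_zero, ← h]; exact hSig.pos m hm
  · exact hSig.strictAnti m hm (m + 1) (mem_Icc.2 ⟨by omega, h⟩) (by omega)

theorem le_of_le {j k : ℕ} (hj : 1 ≤ j) (hk : k ≤ r) (hjk : j ≤ k) : γ k ≤ γ j := by
  rcases hjk.eq_or_lt with rfl | h
  · exact le_rfl
  · exact (hSig.strictAnti j (mem_Icc.2 ⟨hj, by omega⟩) k (mem_Icc.2 ⟨by omega, hk⟩) h).le

theorem norm_op_le (hr : 1 ≤ r) : ‖op Sig‖ ≤ γ 1 := by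
  have h1 := (hSig.pos 1 (mem_Icc.2 ⟨le_rfl, hr⟩)).le
  refine ContinuousLinearMap.opNorm_le_bound _ h1 fun x => ?_
  rw [hSig.op_apply]
  refine norm_sum_weighted_le hSig.orthonormal subset_rfl h1 (fun j hj => ?_) x
  exact ⟨(hSig.pos j hj).le, hSig.le_of_le le_rfl (mem_Icc.1 hj).2 (mem_Icc.1 hj).1⟩

theorem op_apply_self {m : ℕ} (hm : m ∈ Icc 1 r) : op Sig (v m) = γ m • v m := by
  rw [hSig.op_apply, sum_eq_single m]
  · rw [hSig.orthonormal m hm m hm]; simp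
  · intro j hj hjm
    rw [hSig.orthonormal j hj m hm, if_neg hjm]; simp
  · exact fun h => absurd hm h

theorem deflation_self {m : ℕ} (hm : m ∈ Icc 1 r) : deflation v (m - 1) (v m) = v m := by
  refine deflation_eq_self fun k hk => ?_
  rw [mem_Icc] at hk hm
  rw [hSig.orthonormal k (mem_Icc.2 ⟨hk.1, by omega⟩) m (mem_Icc.2 hm), if_neg (by omega)]

theorem op_deflation {m : ℕ} (hm : m ∈ Icc 1 r) (x : Vec p) :
    op Sig (deflation v (m - 1) x) = ∑ j ∈ Icc m r, (γ j * inner ℝ (v j) x) • v j := by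
  rw [mem_Icc] at hm
  rw [hSig.op_apply, ← sum_subset (Icc_subset_Icc_left hm.1)]
  · refine sum_congr rfl fun j hj => ?_
    rw [mem_Icc] at hj
    rw [inner_deflation (by omega) hSig.orthonormal x (mem_Icc.2 ⟨by omega, hj.2⟩),
      if_neg (by rw [mem_Icc]; omega)]
  · intro j hj hj'
    rw [inner_deflation (by omega) hSig.orthonormal x hj, if_pos]
    · simp
    · rw [mem_Icc] at hj hj' ⊢
      omega

/-- Both factors are self-adjoint, and so is their product in one order by `op_deflation`; hence it
equals the product in the other order. -/
theorem deflation_comm {m : ℕ} (hm : m ∈ Icc 1 r) :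
    deflation v (m - 1) ∘L op Sig = op Sig ∘L deflation v (m - 1) := by
  refine ContinuousLinearMap.ext fun x => ext_inner_right ℝ fun y => ?_
  rw [ContinuousLinearMap.comp_apply, ContinuousLinearMap.comp_apply, deflation_symm,
    inner_op_symm hSig.isSymm, hSig.op_deflation hm, hSig.op_deflation hm, inner_sum, sum_inner]
  refine sum_congr rfl fun j _ => ?_
  rw [inner_smul_right, inner_smul_left, real_inner_comm x (v j)]
  simp only [conj_trivial]
  ring

theorem norm_op_deflation_le {m : ℕ} (hm : m ∈ Icc 1 r) :
    ‖op Sig ∘L deflation v (m - 1)‖ ≤ γ m := by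
  refine ContinuousLinearMap.opNorm_le_bound _ (hSig.pos m hm).le fun x => ?_
  rw [ContinuousLinearMap.comp_apply, hSig.op_deflation hm]
  rw [mem_Icc] at hm
  refine norm_sum_weighted_le hSig.orthonormal (Icc_subset_Icc_left hm.1)
    (hSig.pos m (mem_Icc.2 hm)).le (fun j hj => ?_) x
  rw [mem_Icc] at hj
  exact ⟨(hSig.pos j (mem_Icc.2 ⟨by omega, hj.2⟩)).le, hSig.le_of_le hm.1 hj.2 hj.1⟩

/-- Deflation leaves the eigenvalues `γ m, …, γ r`. All but the first are at most `γ (m + 1)`, so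
Bessel's inequality bounds their share; for `m = r` the convention `γ (r + 1) = 0` applies. -/
theorem inner_op_deflation_le {m : ℕ} (hm : m ∈ Icc 1 r) (x : Vec p) :
    inner ℝ (op Sig (deflation v (m - 1) x)) (deflation v (m - 1) x)
      ≤ γ (m + 1) * ‖x‖ ^ 2 + (γ m - γ (m + 1)) * (inner ℝ (v m) x : ℝ) ^ 2 := by
  rw [hSig.op_deflation hm, sum_inner]
  have hnn := hSig.next_nonneg hm
  rw [mem_Icc] at hm
  calc ∑ j ∈ Icc m r, (inner ℝ ((γ j * inner ℝ (v j) x) • v j) (deflation v (m - 1) x) : ℝ)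
      = ∑ j ∈ Icc m r, γ j * (inner ℝ (v j) x : ℝ) ^ 2 := by
        refine sum_congr rfl fun j hj => ?_
        rw [mem_Icc] at hj
        rw [inner_smul_left, inner_deflation (by omega) hSig.orthonormal x
          (mem_Icc.2 ⟨by omega, hj.2⟩), if_neg (by rw [mem_Icc]; omega)]
        simp only [conj_trivial]
        ring
    _ ≤ ∑ j ∈ Icc m r, (γ (m + 1) * (inner ℝ (v j) x : ℝ) ^ 2
          + if j = m then (γ m - γ (m + 1)) * (inner ℝ (v m) x : ℝ) ^ 2 else 0) := by
        refine sum_le_sum fun j hj => ?_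
        rw [mem_Icc] at hj
        split_ifs with h
        · subst h; linarith
        · rw [add_zero]
          exact mul_le_mul_of_nonneg_right (hSig.le_of_le (by omega) hj.2 (by omega)) (sq_nonneg _)
    _ = γ (m + 1) * ∑ j ∈ Icc m r, (inner ℝ (v j) x : ℝ) ^ 2
          + (γ m - γ (m + 1)) * (inner ℝ (v m) x : ℝ) ^ 2 := by
        rw [sum_add_distrib, ← mul_sum, sum_ite_eq', if_pos (mem_Icc.2 ⟨le_rfl, hm.2⟩)]
    _ ≤ _ := by
        have := mul_le_mul_of_nonneg_left
          (sum_inner_sq_le hSig.orthonormal (Icc_subset_Icc_left hm.1) x) hnn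
        linarith

end IsSignal


/-! ### Block vectors -/

theorem subVec_eq_zero {x : Vec p} {J : Finset (Fin I)} (hx : ∀ s : Coord p, s.1 ∉ J → x s = 0)
    {k : Fin I} (hk : k ∉ J) : subVec x k = 0 := by
  ext a; exact hx ⟨k, a⟩ hk

theorem eq_zero_of_notMem_blockSupport {x : Vec p} {s : Coord p} (hs : s.1 ∉ blockSupport x) :
    x s = 0 := by
  simp only [blockSupport, mem_filter, mem_univ, true_and, not_not] at hs
  have h := norm_eq_zero.1 hs
  exact congrArg (fun z : EuclideanSpace ℝ (Fin (p s.1)) => z s.2) h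

theorem blockSupport_subset {x : Vec p} {J : Finset (Fin I)}
    (hx : ∀ s : Coord p, s.1 ∉ J → x s = 0) : blockSupport x ⊆ J := by
  intro k hk
  by_contra h
  simp only [blockSupport, mem_filter, mem_univ, true_and] at hk
  exact hk (by rw [subVec_eq_zero hx h, norm_zero])

theorem sum_norm_subVec_sq (x : Vec p) : ∑ k, ‖subVec x k‖ ^ 2 = ‖x‖ ^ 2 := by
  rw [EuclideanSpace.real_norm_sq_eq, sum_coord]
  exact sum_congr rfl fun k _ => by rw [EuclideanSpace.real_norm_sq_eq]; rfl

theorem norm_subVec_le (x : Vec p) (k : Fin I) : ‖subVec x k‖ ≤ ‖x‖ := by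
  rw [← sq_le_sq₀ (norm_nonneg _) (norm_nonneg _), ← sum_norm_subVec_sq]
  exact single_le_sum (f := fun k => ‖subVec x k‖ ^ 2) (fun _ _ => sq_nonneg _) (mem_univ k)

theorem frob_sq_eq_sum_block (A : Mat p) : frob A ^ 2 = ∑ k, ∑ l, frob (block A k l) ^ 2 := by
  have h := traceInner_eq_sum_block A A
  rw [traceInner_eq_sum] at h
  simp only [frob_sq]
  simpa only [sq] using h

/-! ### Weights and dual norms -/

section Weights

variable {w : Fin I → Fin I → ℝ}

theorem le_maxWeight (w : Fin I → Fin I → ℝ) (k l : Fin I) : w k l ≤ maxWeight w :=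
  le_ciSup (f := fun q : Fin I × Fin I => w q.1 q.2) (Set.finite_range _).bddAbove (k, l)

theorem minWeight_le (w : Fin I → Fin I → ℝ) (k l : Fin I) : minWeight w ≤ w k l :=
  ciInf_le (f := fun q : Fin I × Fin I => w q.1 q.2) (Set.finite_range _).bddBelow (k, l)

theorem frob_block_le (hw : ∀ k l, 0 < w k l) (E : Mat p) (k l : Fin I) :
    frob (block E k l) ≤ w k l * blockMaxNorm w E := by
  rw [mul_comm, ← div_le_iff₀ (hw k l)]
  exact le_ciSup (f := fun q : Fin I × Fin I => frob (block E q.1 q.2) / w q.1 q.2)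
    (Set.finite_range _).bddAbove (k, l)

theorem blockMaxNorm_nonneg (hw : ∀ k l, 0 < w k l) (E : Mat p) : 0 ≤ blockMaxNorm w E :=
  Real.iSup_nonneg fun q => div_nonneg (frob_nonneg _) (hw q.1 q.2).le

theorem crossNorm_nonneg (w : Fin I → Fin I → ℝ) (J : Finset (Fin I)) (A : Mat p) :
    0 ≤ crossNorm w J A :=
  Real.iSup_nonneg fun _ => Real.sqrt_nonneg _

theorem sqrt_le_crossNorm (w : Fin I → Fin I → ℝ) {J : Finset (Fin I)} (A : Mat p) {l : Fin I}
    (hl : l ∉ J) : Real.sqrt (∑ k ∈ J, frob (block A k l) ^ 2 / w k l ^ 2) ≤ crossNorm w J A :=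
  le_ciSup (f := fun l : {l : Fin I // l ∉ J} =>
    Real.sqrt (∑ k ∈ J, frob (block A k l) ^ 2 / w k l ^ 2)) (Set.finite_range _).bddAbove ⟨l, hl⟩

/-- A matrix maps vectors supported in `J` to vectors whose blocks outside `J` are controlled by the
cross norm. -/
theorem norm_subVec_op_le (hw : ∀ k l, 0 < w k l) {A : Mat p} (hA : A.IsSymm)
    {J : Finset (Fin I)} {x : Vec p} (hx : ∀ s : Coord p, s.1 ∉ J → x s = 0) {l : Fin I}
    (hl : l ∉ J) : ‖subVec (op A x) l‖ ≤ maxWeight w * (crossNorm w J A * ‖x‖) := by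
  have hw1 : 0 ≤ maxWeight w := (hw l l).le.trans (le_maxWeight w l l)
  have h1 : subVec (op A x) l = ∑ k ∈ J,
      (WithLp.toLp 2 ((block A l k).mulVec (subVec x k).ofLp) : EuclideanSpace ℝ (Fin (p l))) := by
    ext a
    have h2 : subVec (op A x) l a = ∑ k, ∑ b, A ⟨l, a⟩ ⟨k, b⟩ * x ⟨k, b⟩ := by
      rw [← sum_coord fun t => A ⟨l, a⟩ t * x t, ← op_apply]; rfl
    rw [h2, WithLp.ofLp_sum, Finset.sum_apply]
    refine (sum_subset (subset_univ J) fun k _ hk => ?_).symm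
    exact sum_eq_zero fun b _ => by
      change A ⟨l, a⟩ ⟨k, b⟩ * x ⟨k, b⟩ = 0
      rw [hx ⟨k, b⟩ hk, mul_zero]
  -- The operator uses the blocks in row `l`, the cross norm those in column `l`; symmetry
  -- identifies their norms.
  have hblock : ∀ k, frob (block A l k) = frob (block A k l) := fun k => by
    rw [← frob_transpose (block A k l), ← block_transpose, hA.eq]
  rw [h1]
  calc _ ≤ ∑ k ∈ J, frob (block A k l) * ‖subVec x k‖ :=
        (norm_sum_le _ _).trans (sum_le_sum fun k _ => by
          rw [← hblock]; exact norm_mulVec_le_frob _ _)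
    _ ≤ ∑ k ∈ J, maxWeight w * (frob (block A k l) / w k l * ‖subVec x k‖) := by
        refine sum_le_sum fun k _ => ?_
        rw [← mul_assoc]
        refine mul_le_mul_of_nonneg_right ?_ (norm_nonneg _)
        rw [mul_div_assoc', le_div_iff₀ (hw k l), mul_comm]
        exact mul_le_mul_of_nonneg_right (le_maxWeight w k l) (frob_nonneg _)
    _ = maxWeight w * ∑ k ∈ J, frob (block A k l) / w k l * ‖subVec x k‖ := by rw [mul_sum]
    _ ≤ maxWeight w * (Real.sqrt (∑ k ∈ J, (frob (block A k l) / w k l) ^ 2)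
          * Real.sqrt (∑ k ∈ J, ‖subVec x k‖ ^ 2)) :=
        mul_le_mul_of_nonneg_left (Real.sum_mul_le_sqrt_mul_sqrt _ _ _) hw1
    _ ≤ _ := by
        refine mul_le_mul_of_nonneg_left (mul_le_mul ?_ ?_ (Real.sqrt_nonneg _)
          (crossNorm_nonneg w J A)) hw1
        · simpa only [div_pow] using sqrt_le_crossNorm w A hl
        · rw [← Real.sqrt_sq (norm_nonneg x), ← sum_norm_subVec_sq]
          exact Real.sqrt_le_sqrt (sum_le_sum_of_subset_of_nonneg (subset_univ J)
            fun _ _ _ => sq_nonneg _)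

end Weights

/-! ### Restriction to a set of blocks -/

/-- The coordinate projection onto the blocks in `J`. -/
noncomputable def restrict (J : Finset (Fin I)) : Vec p →L[ℝ] Vec p :=
  op (Matrix.diagonal fun s => if s.1 ∈ J then 1 else 0)

theorem restrict_apply (J : Finset (Fin I)) (x : Vec p) (s : Coord p) :
    restrict J x s = if s.1 ∈ J then x s else 0 := by
  simp [restrict, op_apply, Matrix.diagonal_apply]

theorem restrict_eq_self_iff {J : Finset (Fin I)} {x : Vec p} :
    restrict J x = x ↔ ∀ s : Coord p, s.1 ∉ J → x s = 0 := by
  constructor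
  · intro h s hs
    rw [← h, restrict_apply, if_neg hs]
  · intro h
    ext s
    rw [restrict_apply]
    split_ifs with hs
    · rfl
    · exact (h s hs).symm

theorem restrict_symm (J : Finset (Fin I)) (x y : Vec p) :
    inner ℝ (restrict J x) y = inner ℝ x (restrict J y) :=
  inner_op_symm (Matrix.isSymm_diagonal _) x y

theorem restrict_idem (J : Finset (Fin I)) (x : Vec p) :
    restrict J (restrict J x) = restrict J x :=
  restrict_eq_self_iff.2 fun s hs => by rw [restrict_apply, if_neg hs]

/-- This is where the support of the earlier estimates enters: the two projections commute, so
deflating a vector supported in `J` keeps it there. -/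
theorem deflation_restrict {u : ℕ → Vec p} {n : ℕ} {J : Finset (Fin I)}
    (hu : ∀ k ∈ Icc 1 n, ∀ s : Coord p, s.1 ∉ J → u k s = 0) (x : Vec p) :
    deflation u n (restrict J x) = restrict J (deflation u n x) := by
  rw [deflation_apply, deflation_apply, map_sub, map_sum]
  congr 1
  refine sum_congr rfl fun k hk => ?_
  have h := restrict_eq_self_iff.2 (hu k hk)
  rw [map_smul, h, ← restrict_symm, h]

/-- The part of a matrix supported in `J × J`. -/
noncomputable def diagPart (J : Finset (Fin I)) (A : Mat p) : Mat p :=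
  Matrix.of fun s t => if s.1 ∈ J ∧ t.1 ∈ J then A s t else 0

theorem block_diagPart (J : Finset (Fin I)) (A : Mat p) (k l : Fin I) :
    block (diagPart J A) k l = if k ∈ J ∧ l ∈ J then block A k l else 0 := by
  ext a b
  by_cases h : k ∈ J ∧ l ∈ J <;> simp [block, diagPart, h]

/-- The `J.card²` blocks in `J × J` are the source of the factor s₂ in λs₂w₁. -/
theorem frob_diagPart_le {J : Finset (Fin I)} {A : Mat p} {c : ℝ} (hc : 0 ≤ c)
    (hA : ∀ k l, frob (block A k l) ≤ c) : frob (diagPart J A) ≤ J.card * c := by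
  rw [← sq_le_sq₀ (frob_nonneg _) (by positivity), frob_sq_eq_sum_block]
  calc ∑ k, ∑ l, frob (block (diagPart J A) k l) ^ 2
      = ∑ k ∈ J, ∑ l ∈ J, frob (block A k l) ^ 2 := by
        rw [← sum_subset (subset_univ J)]
        · refine sum_congr rfl fun k hk => ?_
          rw [← sum_subset (subset_univ J)]
          · exact sum_congr rfl fun l hl => by rw [block_diagPart, if_pos ⟨hk, hl⟩]
          · intro l _ hl
            rw [block_diagPart, if_neg fun h => hl h.2, frob_zero, zero_pow two_ne_zero]
        · intro k _ hk
          refine sum_eq_zero fun l _ => ?_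
          rw [block_diagPart, if_neg fun h => hk h.1, frob_zero, zero_pow two_ne_zero]
    _ ≤ ∑ k ∈ J, ∑ l ∈ J, c ^ 2 := sum_le_sum fun k _ => sum_le_sum fun l _ =>
        pow_le_pow_left₀ (frob_nonneg _) (hA k l) 2
    _ = (J.card * c) ^ 2 := by simp; ring

/-- The symmetric part of a matrix. -/
noncomputable def symmPart (A : Mat p) : Mat p := (1 / 2 : ℝ) • (A + A.transpose)

theorem symmPart_isSymm (A : Mat p) : (symmPart A).IsSymm := by
  rw [Matrix.IsSymm, symmPart, Matrix.transpose_smul, Matrix.transpose_add,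
    Matrix.transpose_transpose, add_comm]

/-- Only quadratic forms are compared on the Fantope, so a nonsymmetric dual matrix may be
symmetrized at no cost. -/
theorem inner_op_symmPart (A : Mat p) (x : Vec p) :
    inner ℝ (op (symmPart A) x) x = inner ℝ (op A x) x := by
  rw [symmPart, op_smul, op_add, _root_.smul_apply, _root_.add_apply, inner_smul_left,
    inner_add_left, inner_op_transpose, real_inner_comm x (op A x)]
  simp only [conj_trivial]
  ring

theorem norm_op_symmPart_le (A : Mat p) : ‖op (symmPart A)‖ ≤ frob A := by
  refine (norm_op_le_frob _).trans ?_
  rw [symmPart, frob_smul]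
  have := frob_add_le A A.transpose
  rw [frob_transpose] at this
  rw [abs_of_pos (by norm_num)]
  linarith

theorem restrict_op_symmPart_diagPart (J : Finset (Fin I)) (A : Mat p) (x : Vec p) :
    restrict J (op (symmPart (diagPart J A)) x) = op (symmPart (diagPart J A)) x := by
  refine restrict_eq_self_iff.2 fun s hs => ?_
  rw [op_apply]
  exact sum_eq_zero fun t _ => by simp [symmPart, diagPart, hs]

/-! ### The constants -/

theorem bConst_ge {lam : ℝ} (hlam : 0 ≤ lam) {w : Fin I → Fin I → ℝ} (hw1 : 0 ≤ maxWeight w)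
    {Sig : Mat p} {r : ℕ} {γ : ℕ → ℝ} {v : ℕ → Vec p} (hSig : IsSignal Sig r γ v)
    (vh : ℕ → Vec p) (s₂ : ℕ) {m : ℕ} (hm : m ∈ Icc 1 r) :
    4 * (2 * (lam * s₂ * maxWeight w) + 2 * γ m * eps v vh (m - 1)
      + γ 1 * eps v vh (m - 1) ^ 2) / (γ m - γ (m + 1)) ≤ bConst lam w s₂ γ v vh m := by
  have hm' := mem_Icc.1 hm
  refine single_le_sum (f := fun k => 4 * (2 * (lam * s₂ * maxWeight w) + 2 * γ k * eps v vh (k - 1)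
      + γ 1 * eps v vh (k - 1) ^ 2) / (γ k - γ (k + 1))) (fun k hk => ?_)
      (mem_Icc.2 ⟨hm'.1, le_rfl⟩)
  have hk' : k ∈ Icc 1 r := Icc_subset_Icc_right hm'.2 hk
  have h1 := hSig.gap_pos hk'
  have h2 := (hSig.pos k hk').le
  have h3 := (hSig.pos 1 (mem_Icc.2 ⟨le_rfl, hm'.1.trans hm'.2⟩)).le
  have h4 := eps_nonneg v vh (k - 1)
  have : 0 ≤ lam * s₂ * maxWeight w := by positivity
  exact div_nonneg (by positivity) (by linarith)

/-- Write η for `2 * δ + 2 * γm * ε + γ₁ * ε ^ 2`. The gap exceeds `4 * γ₁ * b`, and `γ₁ * b ≥ (γm -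
γ') * b ≥ 4η`, whence the factor 16. If `ε ≥ 1`, then η would be at least twice the gap. -/
theorem perturbation_bounds {γ₁ γm γ' ε δ b : ℝ} (h1 : γm ≤ γ₁) (hγ' : 0 ≤ γ') (hg : γ' < γm)
    (hε : 0 ≤ ε) (hδ : 0 ≤ δ)
    (hb : 4 * (2 * δ + 2 * γm * ε + γ₁ * ε ^ 2) / (γm - γ') ≤ b)
    (hgap : 0 < γm - γ' - 4 * (δ + γ₁ * b)) :
    16 * (2 * δ + 2 * γm * ε + γ₁ * ε ^ 2) < γm - γ' ∧ ε < 1 ∧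
      4 * (2 * δ + 2 * γm * ε + γ₁ * ε ^ 2) ≤ (γm - γ') * b := by
  have hg' : 0 < γm - γ' := by linarith
  rw [div_le_iff₀ hg', mul_comm b] at hb
  have hη : 0 ≤ 2 * δ + 2 * γm * ε + γ₁ * ε ^ 2 := by
    have : 0 ≤ γm := by linarith
    have : 0 ≤ γ₁ := by linarith
    positivity
  have hb0 : 0 ≤ b := nonneg_of_mul_nonneg_right (by linarith) hg'
  have h2 : (γm - γ') * b ≤ γ₁ * b := mul_le_mul_of_nonneg_right (by linarith) hb0
  have h3 : 16 * (2 * δ + 2 * γm * ε + γ₁ * ε ^ 2) < γm - γ' := by linarith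
  refine ⟨h3, ?_, hb⟩
  by_contra hc
  push Not at hc
  have h4 : (γm - γ') * 1 ≤ γm * ε := mul_le_mul (by linarith) hc zero_le_one (by linarith)
  have h5 : 0 ≤ γ₁ * ε ^ 2 := mul_nonneg (by linarith) (sq_nonneg ε)
  linarith


/-! ### Primal-dual witness and a single step of the procedure -/

/-- The symmetric rank two matrix `c xᵀ + x cᵀ`. -/
noncomputable def crossOuter (c x : Vec p) : Mat p :=
  Matrix.vecMulVec c.ofLp x.ofLp + Matrix.vecMulVec x.ofLp c.ofLp

theorem inner_op_crossOuter (c x y : Vec p) :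
    (inner ℝ (op (crossOuter c x) y) y : ℝ) = 2 * inner ℝ c y * inner ℝ x y := by
  have h : ∀ a b : Vec p, (inner ℝ (op (Matrix.vecMulVec a.ofLp b.ofLp) y) y : ℝ)
      = inner ℝ a y * inner ℝ b y := by
    intro a b
    rw [inner_op, inner_eq_sum, inner_eq_sum, sum_mul_sum]
    exact sum_congr rfl fun s _ => sum_congr rfl fun t _ => by
      rw [Matrix.vecMulVec_apply]; ring
  rw [crossOuter, op_add, _root_.add_apply, inner_add_left, h, h]
  ring

/-- As `x` lives on `J` and `c` off `J`, at most one of the two rank one terms is nonzero in each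
block, so the bound is `C` and not `2 * C`. -/
theorem frob_block_crossOuter_le {c x : Vec p} {J : Finset (Fin I)} (hx : ‖x‖ = 1)
    (hxJ : ∀ s : Coord p, s.1 ∉ J → x s = 0) (hcJ : ∀ s : Coord p, s.1 ∈ J → c s = 0) {C : ℝ}
    (hc : ∀ k ∉ J, ‖subVec c k‖ ≤ C) {k l : Fin I} (hkl : ¬(k ∈ J ∧ l ∈ J)) :
    frob (block (crossOuter c x) k l) ≤ C := by
  have h1 : block (crossOuter c x) k l
      = Matrix.vecMulVec (subVec c k).ofLp (subVec x l).ofLp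
        + Matrix.vecMulVec (subVec x k).ofLp (subVec c l).ofLp := rfl
  have hc0 : ∀ k ∈ J, subVec c k = 0 := fun k hk => by ext a; exact hcJ ⟨k, a⟩ hk
  have hx1 : ∀ k, ‖subVec x k‖ ≤ 1 := fun k => hx ▸ norm_subVec_le x k
  rw [h1]
  refine (frob_add_le _ _).trans ?_
  rw [frob_vecMulVec, frob_vecMulVec]
  by_cases hk : k ∈ J
  · have hl : l ∉ J := fun h => hkl ⟨hk, h⟩
    rw [hc0 k hk, norm_zero, zero_mul, zero_add]
    have := mul_le_mul (hx1 k) (hc l hl) (norm_nonneg _) zero_le_one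
    linarith
  · rw [subVec_eq_zero hxJ hk, norm_zero, zero_mul, add_zero]
    have h2 := hc k hk
    have := mul_le_mul h2 (hx1 l) (norm_nonneg _) ((norm_nonneg _).trans h2)
    linarith

theorem traceInner_congr_of_restricted {A B P H : Mat p} {J : Finset (Fin I)}
    (hAB : ∀ s t : Coord p, s.1 ∈ J → t.1 ∈ J → A s t = B s t)
    (hH : H ∈ restrictedFantope P J) : traceInner A H = traceInner B H := by
  rw [traceInner_eq_sum, traceInner_eq_sum]
  refine sum_congr rfl fun s _ => sum_congr rfl fun t _ => ?_
  by_cases h : s.1 ∈ J ∧ t.1 ∈ J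
  · rw [hAB s t h.1 h.2]
  · rw [hH.2 s t h]; simp

/-- A primal-dual witness: a dual certificate for the restricted problem that extends to a dual
certificate with a spectral gap shows that the full problem has exactly one solution. -/
theorem isSolution_iff_of_certificate {S : Mat p} {lam : ℝ} {w : Fin I → Fin I → ℝ}
    {vh : ℕ → Vec p} {n : ℕ} {J : Finset (Fin I)} {H₀ Y Z : Mat p} {u : Vec p} {μ κ : ℝ}
    (hH₀ : H₀ ∈ restrictedFantope (projSum vh n) J)
    (hYH : traceInner Y H₀ = lam * groupPenalty w H₀)
    (hYmax : ∀ X ∈ restrictedFantope (projSum vh n) J,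
      traceInner (S - Y) X ≤ traceInner (S - Y) H₀)
    (hZY : ∀ s t : Coord p, s.1 ∈ J → t.1 ∈ J → Z s t = Y s t)
    (hZ : ∀ k l, frob (block Z k l) ≤ lam * w k l)
    (hu : ‖u‖ = 1) (huvh : ∀ k ∈ Icc 1 n, (inner ℝ (vh k) u : ℝ) = 0)
    (huJ : ∀ s : Coord p, s.1 ∉ J → u s = 0) (hκ : 0 < κ)
    (hμ : (inner ℝ (op (S - Z) u) u : ℝ) = μ)
    (hgap : ∀ y : Vec p, (∀ k ∈ Icc 1 n, (inner ℝ (vh k) y : ℝ) = 0) →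
      inner ℝ (op (S - Z) y) y ≤ μ * ‖y‖ ^ 2 - κ * ‖y - (inner ℝ u y : ℝ) • u‖ ^ 2)
    (H : Mat p) : IsSolution S lam 0 w (projSum vh n) H ↔ H = outer u := by
  have hmem : outer u ∈ deflatedFantope (projSum vh n) := outer_mem_deflatedFantope hu huvh
  have hmemJ : outer u ∈ restrictedFantope (projSum vh n) J := by
    refine ⟨hmem, fun s t h => ?_⟩
    rw [outer, Matrix.of_apply]
    rcases not_and_or.1 h with h | h <;> simp [huJ _ h]
  have hSZ : ∀ X ∈ restrictedFantope (projSum vh n) J,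
      traceInner (S - Z) X = traceInner (S - Y) X := fun X hX =>
    traceInner_congr_of_restricted (fun s t hs ht => by simp [hZY s t hs ht]) hX
  have hval : traceInner (S - Z) (outer u) = μ := by rw [traceInner_outer, hμ]
  -- `Y` and `Z` agree on `J × J`, so `H₀` also maximizes `⟨S - Z, ·⟩` among restricted matrices;
  -- the gap then identifies it.
  have hH₀u : H₀ = outer u := by
    refine (traceInner_le_of_gap hu hκ hgap hH₀.1).2 ?_
    rw [← hval, hSZ _ hH₀, hSZ _ hmemJ]
    exact hYmax _ hmemJ
  subst hH₀u
  have hZu : traceInner Z (outer u) = lam * groupPenalty w (outer u) := by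
    rw [← hYH]; exact traceInner_congr_of_restricted hZY hmemJ
  have hobju : objective S lam 0 w (outer u) = μ := by
    rw [objective_zero, ← hval, sub_traceInner, hZu]
  -- Weak duality: the linear functional dominates the objective everywhere and equals it at `outer
  -- u`.
  have hobj : ∀ X, objective S lam 0 w X ≤ traceInner (S - Z) X := fun X => by
    rw [objective_zero, sub_traceInner]
    linarith [traceInner_le_groupPenalty hZ X]
  constructor
  · rintro ⟨hH, hmax⟩
    refine (traceInner_le_of_gap hu hκ hgap hH).2 ?_
    have h1 : objective S lam 0 w (outer u) ≤ objective S lam 0 w H := hmax hmem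
    rw [hobju] at h1
    exact h1.trans (hobj H)
  · rintro rfl
    refine ⟨hmem, fun X hX => ?_⟩
    change objective S lam 0 w X ≤ objective S lam 0 w (outer u)
    rw [hobju]
    exact (hobj X).trans (traceInner_le_of_gap hu hκ hgap hX).1

/-- The witness comes from `x` by removing its components along the earlier estimates and
normalizing; `eps < 1` keeps it nonzero. -/
theorem restrictedFantope_nonempty {vh v : ℕ → Vec p} {n : ℕ} {J : Finset (Fin I)}
    (hvh : ∀ j ∈ Icc 1 n, ∀ k ∈ Icc 1 n, inner ℝ (vh j) (vh k) = if j = k then (1 : ℝ) else 0)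
    (hvhJ : ∀ k ∈ Icc 1 n, ∀ s : Coord p, s.1 ∉ J → vh k s = 0) {x : Vec p} (hx : ‖x‖ = 1)
    (hxJ : ∀ s : Coord p, s.1 ∉ J → x s = 0) (hxv : deflation v n x = x)
    (hε : eps v vh n < 1) : (restrictedFantope (projSum vh n) J).Nonempty := by
  set y := deflation vh n x with hy
  have hy0 : y ≠ 0 := by
    intro h0
    have h1 : (deflation vh n - deflation v n) x = -x := by
      rw [_root_.sub_apply, ← hy, h0, hxv, zero_sub]
    have h2 := (deflation vh n - deflation v n).le_of_opNorm_le
      (norm_deflation_sub_deflation_le v vh n) x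
    rw [h1, norm_neg, hx] at h2
    linarith
  have hyJ : ∀ s : Coord p, s.1 ∉ J → y s = 0 := by
    rw [← restrict_eq_self_iff, hy, ← deflation_restrict hvhJ, restrict_eq_self_iff.2 hxJ]
  refine ⟨outer (‖y‖⁻¹ • y), outer_mem_deflatedFantope ?_ fun k hk => ?_, fun s t h => ?_⟩
  · rw [norm_smul, norm_inv, norm_norm, inv_mul_cancel₀ (norm_ne_zero_iff.2 hy0)]
  · rw [inner_smul_right, inner_eq_zero_of_deflation_eq_self hvh (deflation_idem hvh x) hk,
      mul_zero]
  · rw [outer, Matrix.of_apply]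
    rcases not_and_or.1 h with h | h <;> simp [hyJ _ h]

/-- One step of the procedure: if the earlier estimates are orthonormal and supported in `J`, the
problem has exactly one solution, which is a rank one projection onto a vector supported in `J`. -/
theorem exists_rank_one_solution {w : Fin I → Fin I → ℝ} (hw : ∀ k l, 0 < w k l) {S Sig : Mat p}
    {r : ℕ} {γ : ℕ → ℝ} {v : ℕ → Vec p} (hSig : IsSignal Sig r γ v)
    {lam : ℝ} (hlam : 0 ≤ lam) {J : Finset (Fin I)} {m : ℕ} (hm : m ∈ Icc 1 r)
    (hvJ : ∀ s : Coord p, s.1 ∉ J → v m s = 0) {vh : ℕ → Vec p}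
    (hvh : ∀ j ∈ Icc 1 (m - 1), ∀ k ∈ Icc 1 (m - 1),
      inner ℝ (vh j) (vh k) = if j = k then (1 : ℝ) else 0)
    (hvhJ : ∀ k ∈ Icc 1 (m - 1), ∀ s : Coord p, s.1 ∉ J → vh k s = 0)
    (hdual : blockMaxNorm w (S - Sig) + bConst lam w J.card γ v vh m * crossNorm w J Sig
      ≤ minWeight w / maxWeight w * lam)
    (hgap : 0 < γ m - γ (m + 1)
      - 4 * (lam * J.card * maxWeight w + γ 1 * bConst lam w J.card γ v vh m)) :
    ∃ u : Vec p, ‖u‖ = 1 ∧ (∀ k ∈ Icc 1 (m - 1), (inner ℝ (vh k) u : ℝ) = 0) ∧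
      (∀ s : Coord p, s.1 ∉ J → u s = 0) ∧
      ∀ H, IsSolution S lam 0 w (projSum vh (m - 1)) H ↔ H = outer u := by
  have hm' := mem_Icc.1 hm
  have hv1 : ‖v m‖ = 1 := norm_eq_one_of_orthonormal hSig.orthonormal hm
  -- With no views the supremum defining `maxWeight` would be 0; the unit vector `v m` rules this
  -- out.
  obtain ⟨k₀⟩ : Nonempty (Fin I) := by
    by_contra hne
    rw [not_nonempty_iff] at hne
    have h0 : v m = 0 := by ext s; exact hne.elim s.1
    rw [h0, norm_zero] at hv1
    exact zero_ne_one hv1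
  have hw1 : 0 < maxWeight w := (hw k₀ k₀).trans_le (le_maxWeight w k₀ k₀)
  set b := bConst lam w J.card γ v vh m with hb
  set ε := eps v vh (m - 1) with hεd
  have hε0 : 0 ≤ ε := eps_nonneg v vh (m - 1)
  have hgp := hSig.gap_pos hm
  have hδ0 : 0 ≤ lam * J.card * maxWeight w := by positivity
  obtain ⟨hη16, hε1, hηb⟩ := perturbation_bounds (hSig.le_of_le le_rfl hm'.2 hm'.1)
    (hSig.next_nonneg hm) hgp hε0 hδ0 (bConst_ge hlam hw1.le hSig vh J.card hm) hgap
  have hvm := hSig.deflation_self hm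
  obtain ⟨H₀, hH₀, Y, hY1, hY2, hY3⟩ := exists_restricted_solution hw hlam S
    (restrictedFantope_nonempty hvh hvhJ hv1 hvJ hvm hε1)
  have hcr := crossNorm_nonneg w J Sig
  have hbm := blockMaxNorm_nonneg hw (S - Sig)
  -- the dual condition, multiplied by the weights
  have hdual' : maxWeight w * (blockMaxNorm w (S - Sig) + b * crossNorm w J Sig)
      ≤ minWeight w * lam := by
    refine (mul_le_mul_of_nonneg_left hdual hw1.le).trans_eq ?_
    field_simp
  have hcross : ∀ x : Vec p, ‖x‖ ≤ b → crossNorm w J Sig * ‖x‖ ≤ b * crossNorm w J Sig :=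
    fun x hx => by rw [mul_comm b]; exact mul_le_mul_of_nonneg_left hx hcr
  have hb0 : 0 ≤ b := by
    have hg' : 0 < γ m - γ (m + 1) := by linarith
    refine nonneg_of_mul_nonneg_right (le_trans ?_ hηb) hg'
    have := (hSig.pos m hm).le
    have := (hSig.pos 1 (mem_Icc.2 ⟨le_rfl, hm'.1.trans hm'.2⟩)).le
    positivity
  have hE : ∀ k l, frob (block (S - Sig) k l) ≤ maxWeight w * blockMaxNorm w (S - Sig) :=
    fun k l => (frob_block_le hw _ k l).trans
      (mul_le_mul_of_nonneg_right (le_maxWeight w k l) hbm)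
  have hmaxlam : minWeight w * lam ≤ lam * maxWeight w := by
    rw [mul_comm]
    exact mul_le_mul_of_nonneg_left ((minWeight_le w k₀ k₀).trans (le_maxWeight w k₀ k₀)) hlam
  -- One `lam * maxWeight w` comes from the noise, through the dual condition, and one from the
  -- subgradient.
  have hEY : ∀ k l, frob (block (S - Sig - Y) k l) ≤ 2 * (lam * maxWeight w) := by
    intro k l
    rw [block_sub (S - Sig)]
    refine (frob_sub_le _ _).trans ?_
    have h1 := hE k l
    have h2 := (hY1 k l).trans (mul_le_mul_of_nonneg_left (le_maxWeight w k l) hlam)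
    have h3 : 0 ≤ maxWeight w * (b * crossNorm w J Sig) := by positivity
    linarith
  have hN : ‖op (symmPart (diagPart J (S - Sig - Y)))‖ ≤ 2 * (lam * J.card * maxWeight w) :=
    ((norm_op_symmPart_le _).trans (frob_diagPart_le (by positivity) hEY)).trans_eq (by ring)
  obtain ⟨u, μ, κ, hu1, hQu, hRu, huv, hκ, hμ, hquad⟩ := exists_leading_vector
    (inner_op_symm hSig.isSymm) (inner_op_symm (symmPart_isSymm (diagPart J (S - Sig - Y))))
    (deflation_symm v (m - 1)) (deflation_symm vh (m - 1)) (restrict_symm J) (deflation_idem hvh)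
    (restrict_idem J) (deflation_restrict hvhJ) (restrict_op_symmPart_diagPart J _)
    (norm_deflation_le hvh) (hSig.deflation_comm hm)
    (norm_deflation_sub_deflation_le v vh (m - 1))
    (hSig.norm_op_le (hm'.1.trans hm'.2)) (hSig.norm_op_deflation_le hm) hN hv1 hvm
    (restrict_eq_self_iff.2 hvJ) (hSig.op_apply_self hm) (hSig.inner_op_deflation_le hm) rfl
    (hSig.next_nonneg hm) hη16 hε1
  have huJ := restrict_eq_self_iff.1 hRu
  have huvh : ∀ k ∈ Icc 1 (m - 1), (inner ℝ (vh k) u : ℝ) = 0 := fun k hk =>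
    inner_eq_zero_of_deflation_eq_self hvh hQu hk
  refine ⟨u, hu1, huvh, huJ, ?_⟩
  set c := op Sig u - restrict J (op Sig u) with hc
  have hcs : ∀ s, c s = if s.1 ∈ J then 0 else op Sig u s := by
    intro s
    rw [hc, PiLp.sub_apply, restrict_apply]
    split_ifs <;> simp
  have hcu : (inner ℝ c u : ℝ) = 0 := by
    rw [hc, inner_sub_left, restrict_symm, hRu, sub_self]
  -- the blocks of `c` outside `J` are small
  have hdist : ‖u - v m‖ ≤ b :=
    le_of_mul_le_mul_left (huv.trans hηb) (by linarith)
  have hcn : ∀ k ∉ J, ‖subVec c k‖ ≤ maxWeight w * (b * crossNorm w J Sig) := by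
    intro k hk
    -- `op Sig (v m) = γ m • v m` vanishes outside `J`, so subtracting `v m` is free and `c`
    -- inherits the smallness of `u - v m`.
    have h1 : subVec c k = subVec (op Sig (u - v m)) k := by
      ext a
      change c ⟨k, a⟩ = op Sig (u - v m) ⟨k, a⟩
      rw [hcs, if_neg hk, map_sub, hSig.op_apply_self hm, PiLp.sub_apply, PiLp.smul_apply,
        hvJ ⟨k, a⟩ hk, smul_zero, sub_zero]
    rw [h1]
    refine (norm_subVec_op_le hw hSig.isSymm (fun s hs => ?_) hk).trans
      (mul_le_mul_of_nonneg_left (hcross _ hdist) hw1.le)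
    rw [PiLp.sub_apply, huJ s hs, hvJ s hs, sub_zero]
  -- the extended dual certificate
  set Z : Mat p := S - Sig - diagPart J (S - Sig - Y) + crossOuter c u with hZ
  have hcJ : ∀ s : Coord p, s.1 ∈ J → c s = 0 := fun s hs => by rw [hcs, if_pos hs]
  have hZY : ∀ s t : Coord p, s.1 ∈ J → t.1 ∈ J → Z s t = Y s t := by
    intro s t hs ht
    simp [hZ, diagPart, crossOuter, Matrix.vecMulVec_apply, hs, ht, hcJ s hs, hcJ t ht]
  have hZn : ∀ k l, frob (block Z k l) ≤ lam * w k l := by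
    intro k l
    by_cases hkl : k ∈ J ∧ l ∈ J
    · have : block Z k l = block Y k l := by
        ext a d
        exact hZY ⟨k, a⟩ ⟨l, d⟩ hkl.1 hkl.2
      rw [this]
      exact hY1 k l
    · have h1 : block Z k l = block (S - Sig) k l + block (crossOuter c u) k l := by
        rw [hZ, block_add, block_sub (S - Sig), block_diagPart, if_neg hkl, sub_zero]
      rw [h1]
      -- Noise and cross term together use exactly the budget `minWeight w * lam` of the dual
      -- condition.
      refine (frob_add_le _ _).trans ?_
      have h2 := frob_block_crossOuter_le hu1 huJ hcJ hcn hkl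
      have h3 := hE k l
      have h4 := mul_le_mul_of_nonneg_left (minWeight_le w k l) hlam
      linarith
  have hSZ : ∀ x : Vec p, (inner ℝ (op (S - Z) x) x : ℝ)
      = inner ℝ (op Sig x) x + inner ℝ (op (symmPart (diagPart J (S - Sig - Y))) x) x
        - 2 * inner ℝ c x * inner ℝ u x := by
    intro x
    have h1 : S - Z = Sig + diagPart J (S - Sig - Y) - crossOuter c u := by
      rw [hZ]; abel
    rw [h1, op_sub, op_add, _root_.sub_apply, _root_.add_apply, inner_sub_left, inner_add_left,
      inner_op_crossOuter, inner_op_symmPart]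
  refine isSolution_iff_of_certificate (μ := μ) hH₀ hY2 hY3 hZY hZn hu1 huvh huJ hκ ?_ fun y hy => ?_
  · rw [hSZ, hcu, hμ]; ring
  · rw [hSZ]
    exact hquad y (deflation_eq_self hy)

theorem isEstimate_iff_of_rank_one {S P : Mat p} {lam : ℝ} {w : Fin I → Fin I → ℝ} {u : Vec p}
    (hu : ‖u‖ = 1) (h : ∀ H, IsSolution S lam 0 w P H ↔ H = outer u) (x : Vec p) :
    IsEstimate S lam 0 w P x ↔ x = u ∨ x = -u := by
  simp [IsEstimate, h, isLeadingEigenvector_outer hu]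

theorem eq_zero_of_notMem_unionSupport {v : ℕ → Vec p} {r₁ m : ℕ} (hm : m ∈ Icc 1 r₁)
    {s : Coord p} (hs : s.1 ∉ unionSupport v r₁) : v m s = 0 := by
  classical
  refine eq_zero_of_notMem_blockSupport fun h => hs ?_
  rw [unionSupport]
  convert (mem_biUnion (t := fun j => blockSupport (v j))).2 ⟨m, hm, h⟩

end MultiviewPCA

/-! ### Induction over the steps -/

open MultiviewPCA in
theorem mainTheorem12 {I : ℕ} {p : Fin I → ℕ}
    (w : Fin I → Fin I → ℝ) (hw : ∀ k l, 0 < w k l)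
    (S Sig : Mat p) (hS : S.IsSymm)
    (r : ℕ) (γ : ℕ → ℝ) (v : ℕ → Vec p) (hSig : IsSignal Sig r γ v)
    (lam : ℝ) (hlam : 0 ≤ lam)
    (r₁ : ℕ) (hr₁ : r₁ ≤ r)
    (J₂ : Finset (Fin I)) (hJ₂ : J₂ = unionSupport v r₁) :
    ∀ m ∈ Finset.Icc 1 r₁, ∀ vh : ℕ → Vec p,
      -- `vh 1, …, vh (m - 1)` are the estimates from the steps before step `m`
      IsEstimateSequence S lam 0 w (m - 1) vh →
      -- the two conditions at every step up to `m`
      (∀ j ∈ Finset.Icc 1 m,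
        blockMaxNorm w (S - Sig) + bConst lam w J₂.card γ v vh j * crossNorm w J₂ Sig
            ≤ minWeight w / maxWeight w * lam ∧
        0 < γ j - γ (j + 1)
            - 4 * (lam * J₂.card * maxWeight w + γ 1 * bConst lam w J₂.card γ v vh j)) →
      -- the problem of step `m` has exactly one solution, its leading eigenvector is unique
      -- up to sign, and the block support of that vector lies in `J₂`
      (∃! H : Mat p, IsSolution S lam 0 w (projSum vh (m - 1)) H) ∧
      (∃ u : Vec p, {x : Vec p | IsEstimate S lam 0 w (projSum vh (m - 1)) x} = {u, -u} ∧
        blockSupport u ⊆ J₂) := by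
  intro m hm vh hseq hcond
  -- Strong induction is needed because step `j` uses orthonormality and support of all earlier
  -- estimates. Each of them is ± the vector found at its own step and so inherits both properties.
  have main : ∀ j ∈ Finset.Icc 1 m, ∃ u : Vec p, ‖u‖ = 1 ∧
      (∀ k ∈ Finset.Icc 1 (j - 1), (inner ℝ (vh k) u : ℝ) = 0) ∧
      (∀ s : Coord p, s.1 ∉ J₂ → u s = 0) ∧
      ∀ H, IsSolution S lam 0 w (projSum vh (j - 1)) H ↔ H = outer u := by
    intro j
    induction j using Nat.strong_induction_on with
    | _ j ih =>
      intro hj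
      rw [Finset.mem_Icc] at hj hm
      have hprev : ∀ i ∈ Finset.Icc 1 (j - 1), ‖vh i‖ = 1 ∧
          (∀ k ∈ Finset.Icc 1 (i - 1), (inner ℝ (vh k) (vh i) : ℝ) = 0) ∧
          ∀ s : Coord p, s.1 ∉ J₂ → vh i s = 0 := by
        intro i hi
        rw [Finset.mem_Icc] at hi
        obtain ⟨u, hu1, hu2, hu3, hu4⟩ := ih i (by omega) (Finset.mem_Icc.2 ⟨hi.1, by omega⟩)
        have hest := hseq i (Finset.mem_Icc.2 ⟨hi.1, by omega⟩)
        rcases (isEstimate_iff_of_rank_one hu1 hu4 (vh i)).1 hest with h | h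
        · rw [h]; exact ⟨hu1, hu2, hu3⟩
        · rw [h]
          refine ⟨by rwa [norm_neg], fun k hk => by rw [inner_neg_right, hu2 k hk, neg_zero],
            fun s hs => by rw [PiLp.neg_apply, hu3 s hs, neg_zero]⟩
      have hon : ∀ i ∈ Finset.Icc 1 (j - 1), ∀ k ∈ Finset.Icc 1 (j - 1),
          inner ℝ (vh i) (vh k) = if i = k then (1 : ℝ) else 0 := by
        intro i hi k hk
        have hi' := Finset.mem_Icc.1 hi
        have hk' := Finset.mem_Icc.1 hk
        rcases lt_trichotomy i k with h | h | h
        · rw [if_neg h.ne]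
          exact (hprev k hk).2.1 i (Finset.mem_Icc.2 ⟨hi'.1, by omega⟩)
        · rw [if_pos h, h, real_inner_self_eq_norm_sq, (hprev k hk).1, one_pow]
        · rw [if_neg h.ne', real_inner_comm]
          exact (hprev i hi).2.1 k (Finset.mem_Icc.2 ⟨hk'.1, by omega⟩)
      obtain ⟨h1, h2⟩ := hcond j (Finset.mem_Icc.2 hj)
      exact exists_rank_one_solution hw hSig hlam (Finset.mem_Icc.2 ⟨hj.1, by omega⟩)
        (fun s hs => eq_zero_of_notMem_unionSupport (Finset.mem_Icc.2 ⟨hj.1, by omega⟩)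
          (hJ₂ ▸ hs)) hon (fun k hk => (hprev k hk).2.2) h1 h2
  obtain ⟨u, hu1, -, hu3, hu4⟩ :=
    main m (Finset.mem_Icc.2 ⟨(Finset.mem_Icc.1 hm).1, le_rfl⟩)
  refine ⟨⟨outer u, (hu4 _).2 rfl, fun H hH => (hu4 H).1 hH⟩, u, ?_, blockSupport_subset hu3⟩
  ext x
  exact isEstimate_iff_of_rank_one hu1 hu4 x
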